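/- Let $\lambda$ be the standard (fair-coin) measure on $\{0,1\}^{\mathbb N}$. A Martin-Löf test is a computable sequence $(U_i)_{i\in\mathbb N}$ of open subsets of $\{0,1\}^{\mathbb N}$ with $\lambda(U_i)\le 2^{-i}$ for all $i$; it is universal if $\bigcap_i V_i\subseteq\bigcap_i U_i$ for every Martin-Löf test $(V_i)_i$. Let $\mathrm{MLR}\subseteq\{0,1\}^{\mathbb N}$ be the set of Martin-Löf random sequences, i.e. of those that lie in $\bigcap_i V_i$ for no Martin-Löf test $(V_i)_i$ (equivalently, the complement of $\bigcap_i U_i$ for any universal test). For a universal Martin-Löf test $\mathcal U=(U_i)_{i\in\mathbb N}$ let $\mathrm{LAY}_{\mathcal U}:\mathrm{MLR}\rightrightarrows\mathbb N$ be the multivalued function with $n\in\mathrm{LAY}_{\mathcal U}(p)$ iff $p\notin U_n$. For represented spaces $\mathbf X,\mathbf Y$, a realizer of a multivalued function $f:\subseteq\mathbf X\rightrightarrows\mathbf Y$ is a partial function $F:\subseteq\mathbb N^{\mathbb N}\to\mathbb N^{\mathbb N}$ that maps every name of every $x\in\mathrm{dom}(f)$ to a name of some element of $f(x)$. For multivalued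 functions $f,g$ between represented spaces, $f$ is Weihrauch reducible to $g$ if there are computable partial functions $K,H:\subseteq\mathbb N^{\mathbb N}\to\mathbb N^{\mathbb N}$ such that $p\mapsto K\langle p,G(H(p))\rangle$ is a realizer of $f$ for every realizer $G$ of $g$; $f$ and $g$ are Weihrauch equivalent, $f\equiv_{\mathrm W}g$, if each is Weihrauch reducible to the other. Here $\mathbb N$, $\mathrm{MLR}\subseteq\{0,1\}^{\mathbb N}$ and $\mathbb R$ carry their standard representations, that of $\mathbb R$ being by sequences of rationals converging with error at most $2^{-n}$ at index $n$. **Theorem.** For every $p\in\mathrm{MLR}$ the series $\sum_{n\ge1}\frac{(-1)^{p(n)}}{n}$ converges (as the limit of its partial sums), and for every universal Martin-Löf test $\mathcal U$ $$\Bigl(p\mapsto\sum_{n\ge1}\frac{(-1)^{p(n)}}{n}:\mathrm{MLR}\to\mathbb R\Bigr)\;\equiv_{\mathrm W}\;\mathrm{LAY}_{\mathcal U}.$$ -/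

import Mathlib

open Filter Topology MeasureTheory
open scoped ENNReal

namespace LayerRed

/-! ### Sequences -/

/-- Baire space `ℕ^ℕ`. -/
abbrev Baire : Type := ℕ → ℕ

/-- Cantor space `{0,1}^ℕ`, with `false` for `0` and `true` for `1`. -/
abbrev Cantor : Type := ℕ → Bool

/-- The prefix of length `n` of an infinite sequence. -/
def pre {α : Type*} (p : ℕ → α) (n : ℕ) : List α := (List.range n).map p

/-- The finite word `w` is a prefix of the infinite sequence `p`. -/
def IsPre {α : Type*} (w : List α) (p : ℕ → α) : Prop := w = pre p w.length

/-- The standard pairing `⟨p, q⟩` on Baire space, by interleaving. -/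
def interleave (p q : Baire) : Baire := fun n => if n % 2 = 0 then p (n / 2) else q (n / 2)

/-! ### Computable partial functions on Baire space -/

/-- A partial function `F : ⊆ ℕ^ℕ → ℕ^ℕ` is computable if there is a computable monotone function
`h` on finite words such that, for each `p` in the domain of `F`, the words `h (p|m)` are prefixes
of `F p` of unbounded length. (As usual, a restriction of a computable function is computable.) -/
def ComputableBaire (F : Baire →. Baire) : Prop :=
  ∃ h : List ℕ → List ℕ, Computable h ∧ (∀ u v, u <+: v → h u <+: h v) ∧
    ∀ p, ∀ q ∈ F p, (∀ m, IsPre (h (pre p m)) q) ∧ ∀ n, ∃ m, n ≤ (h (pre p m)).length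

/-! ### Represented spaces -/

/-- A represented space: a set `X` with a partial surjection `δ : ⊆ ℕ^ℕ → X`, given by its graph
`IsName p x ↔ δ p = x`. -/
class Represented (X : Type*) where
  IsName : Baire → X → Prop
  unique : ∀ {p x y}, IsName p x → IsName p y → x = y
  surj : ∀ x, ∃ p, IsName p x

/-- `ℕ`, represented by `δ p = p 0`. -/
instance : Represented ℕ where
  IsName p n := p 0 = n
  unique h₁ h₂ := h₁.symm.trans h₂
  surj n := ⟨fun _ => n, rfl⟩

/-- Cantor space, represented as the subset `{0,1}^ℕ` of Baire space. -/
instance : Represented Cantor where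
  IsName p x := ∀ n, p n = (x n).toNat
  unique := by
    intro p x y hx hy
    funext n
    have h : (x n).toNat = (y n).toNat := (hx n).symm.trans (hy n)
    revert h
    cases x n <;> cases y n <;> simp
  surj x := ⟨fun n => (x n).toNat, fun _ => rfl⟩

/-- A subset of a represented space, with the restricted representation. -/
instance {X : Type*} [Represented X] (A : Set X) : Represented A where
  IsName p x := Represented.IsName p (x : X)
  unique h₁ h₂ := Subtype.ext (Represented.unique h₁ h₂)
  surj x := Represented.surj (x : X)

/-- A standard numbering of the rationals: the code of `(a, b, c)` stands for `(a - b) / (c + 1)`. -/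
def ratOf (k : ℕ) : ℚ :=
  (((k.unpair.1.unpair.1 : ℕ) : ℚ) - ((k.unpair.1.unpair.2 : ℕ) : ℚ)) / ((k.unpair.2 : ℚ) + 1)

theorem ratOf_surjective : Function.Surjective ratOf := by
  intro r
  refine ⟨Nat.pair (Nat.pair r.num.toNat (-r.num).toNat) (r.den - 1), ?_⟩
  have h₁ : ((r.num.toNat : ℕ) : ℚ) - (((-r.num).toNat : ℕ) : ℚ) = (r.num : ℚ) := by
    have : ((r.num.toNat : ℕ) : ℤ) - (((-r.num).toNat : ℕ) : ℤ) = r.num := by omega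
    exact_mod_cast this
  have h₂ : ((r.den - 1 : ℕ) : ℚ) + 1 = (r.den : ℚ) := by
    have := r.den_pos
    have : r.den - 1 + 1 = r.den := by omega
    exact_mod_cast this
  simp only [ratOf, Nat.unpair_pair]
  rw [h₁, h₂, Rat.num_div_den]

/-- `ℝ` with the Cauchy representation: a name of `x` is a sequence of rationals, the `n`-th of
which is within `2⁻ⁿ` of `x`. -/
instance : Represented ℝ where
  IsName p x := ∀ n, |((ratOf (p n) : ℚ) : ℝ) - x| ≤ (2⁻¹ : ℝ) ^ n
  unique := by
    intro p x y hx hy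
    have h0 : Tendsto (fun n : ℕ => (2⁻¹ : ℝ) ^ n) atTop (𝓝 0) :=
      tendsto_pow_atTop_nhds_zero_of_lt_one (by norm_num) (by norm_num)
    have key : ∀ z : ℝ, (∀ n, |((ratOf (p n) : ℚ) : ℝ) - z| ≤ (2⁻¹ : ℝ) ^ n) →
        Tendsto (fun n => ((ratOf (p n) : ℚ) : ℝ)) atTop (𝓝 z) := by
      intro z hz
      rw [tendsto_iff_dist_tendsto_zero]
      exact squeeze_zero (fun _ => dist_nonneg) (fun n => by rw [Real.dist_eq]; exact hz n) h0
    exact tendsto_nhds_unique (key x hx) (key y hy)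
  surj := by
    intro x
    have h : ∀ n : ℕ, ∃ k : ℕ, |((ratOf k : ℚ) : ℝ) - x| ≤ (2⁻¹ : ℝ) ^ n := by
      intro n
      have hpos : (0 : ℝ) < (2⁻¹ : ℝ) ^ n := by positivity
      obtain ⟨r, hr₁, hr₂⟩ := exists_rat_btwn (lt_add_of_pos_right x hpos)
      obtain ⟨k, rfl⟩ := ratOf_surjective r
      exact ⟨k, by rw [abs_le]; constructor <;> linarith⟩
    choose p hp using h
    exact ⟨p, hp⟩

/-! ### Weihrauch reducibility

A partial multivalued function `f : ⊆ X ⇉ Y` is a map `f : X → Set Y`, whose domain consists of the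
`x` with `f x` nonempty. -/

/-- `F` is a realizer of `f`: it maps each name of a point `x` of the domain of `f` to a name of
some element of `f x`. -/
def Realizes {X Y : Type*} [Represented X] [Represented Y] (F : Baire →. Baire) (f : X → Set Y) :
    Prop :=
  ∀ p x, Represented.IsName p x → (f x).Nonempty →
    ∃ q ∈ F p, ∃ y ∈ f x, Represented.IsName q y

/-- Weihrauch reducibility `f ≤_W g`: for some computable `K, H : ⊆ ℕ^ℕ → ℕ^ℕ`, the partial
function `p ↦ K ⟨p, G (H p)⟩` realizes `f` whenever `G` realizes `g`. -/
def WeihrauchLE {X Y Z W : Type*} [Represented X] [Represented Y] [Represented Z] [Represented W]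
    (f : X → Set Y) (g : Z → Set W) : Prop :=
  ∃ K H : Baire →. Baire, ComputableBaire K ∧ ComputableBaire H ∧
    ∀ G : Baire →. Baire, Realizes G g →
      Realizes (fun p => (H p).bind fun u => (G u).bind fun r => K (interleave p r)) f

/-- Weihrauch equivalence `f ≡_W g`. -/
def WeihrauchEquiv {X Y Z W : Type*} [Represented X] [Represented Y] [Represented Z]
    [Represented W] (f : X → Set Y) (g : Z → Set W) : Prop :=
  WeihrauchLE f g ∧ WeihrauchLE g f

/-! ### Martin-Löf randomness -/

/-- The fair coin measure on `{0,1}`. -/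
noncomputable def coin : Measure Bool := (PMF.uniformOfFintype Bool).toMeasure

instance : IsProbabilityMeasure coin := PMF.toMeasure.isProbabilityMeasure _

/-- The standard (Lebesgue) measure on Cantor space. -/
noncomputable def lebesgue : Measure Cantor := Measure.infinitePi fun _ : ℕ => coin

/-- A computable sequence of open subsets of Cantor space: from `i` one can computably list (with
`none` for no output) finite words `w` such that `U i` is the union of the cylinders `w{0,1}^ℕ`. -/
def ComputableOpenSeq (U : ℕ → Set Cantor) : Prop :=
  ∃ e : ℕ → ℕ → Option (List Bool), Computable₂ e ∧
    ∀ i, U i = {p | ∃ s, ∃ w, e i s = some w ∧ IsPre w p}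

/-- Martin-Löf tests (not necessarily nested). -/
def IsMLTest (U : ℕ → Set Cantor) : Prop :=
  ComputableOpenSeq U ∧ ∀ i, lebesgue (U i) ≤ (2⁻¹ : ℝ≥0∞) ^ i

/-- Universal Martin-Löf tests. -/
def IsUniversalMLTest (U : ℕ → Set Cantor) : Prop :=
  IsMLTest U ∧ ∀ V, IsMLTest V → ⋂ i, V i ⊆ ⋂ i, U i

/-- The set of Martin-Löf random sequences: those which are caught by no Martin-Löf test. -/
def MLR : Set Cantor := {p | ∀ V, IsMLTest V → p ∉ ⋂ i, V i}

/-- `MLR` is the complement of `⋂ i, U i` for any universal test `U`. -/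
theorem MLR_eq_compl {U : ℕ → Set Cantor} (hU : IsUniversalMLTest U) : MLR = (⋂ i, U i)ᶜ := by
  ext p
  exact ⟨fun h => h U hU.1, fun h V hV hp => h (hU.2 V hV hp)⟩

/-! ### The two problems -/

/-- `LAY_U : MLR ⇉ ℕ`, with `n ∈ LAY_U p` iff `p ∉ U n`. -/
def LAY (U : ℕ → Set Cantor) : MLR → Set ℕ := fun p => {n | (p : Cantor) ∉ U n}

/-- The partial sum `∑_{n=1}^{N} (-1)^{p(n)} / n`. -/
noncomputable def harmonicPartial (p : Cantor) (N : ℕ) : ℝ :=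
  ∑ n ∈ Finset.Icc 1 N, (-1 : ℝ) ^ (p n).toNat / (n : ℝ)

/-- The map `p ↦ ∑_{n ≥ 1} (-1)^{p(n)} / n` on `MLR`, the sum being the limit of the partial sums
(a set with at most one element). -/
def randomHarmonic : MLR → Set ℝ :=
  fun p => {x | Tendsto (harmonicPartial (p : Cantor)) atTop (𝓝 x)}

end LayerRed

/-! Both reductions use one device. Suppose `p` is random and lies in only finitely many members of
a computable sequence of open sets `V i`. Copy `p` to `r`, but write zeros as long as `p` has been
seen to enter some `V i` while a condition `Q i`, which an endless run of zeros would bring about,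
is not yet met. Each demand costs finitely many zeros, so `r` differs from `p` in finitely many bits
and is again random, and `Q i` holds whenever `p ∈ V i` (`overwrite_demand`). The oracle is asked
about `r`; its answer bounds the demands that were met, and so says something about `p`.

Sum from a layer: by Kolmogorov's inequality (`lebesgue_exists_le_sq`, via Ville's inequality
`lebesgue_exists_one_le`) the sets `deviating j`, on which the series still moves by more than `2⁻ʲ`
past `cutoff j`, have summable measure. A random `p` avoids almost all of them, so its series
converges. Let `V i` be the union of `deviating j` over `j ≥ i`, and let `Q i` say that `r` has
entered `U i`. Zeros bring this about because a sequence ending in zeros is not random and `U` is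
universal. If `r ∉ U n` then `p ∉ V n`, which gives a modulus of convergence.

Layer from the sum: let `V i` be `U i` together with the sequences having a partial sum below `-i`,
and let `Q i` say that the partial sum of `r` leads that of `p` by at least `2 * (i + 1)`; zeros
bring this about because the harmonic series diverges. If `p ∈ U n`, some `i ≥ n` has `p ∈ V i` and
`p ∉ V (i + 1)`, so the sum of `r` is at least `2 * (i + 1) - (i + 1) > n`. Hence a natural number
above the sum of `r` is a layer of `p`. -/

namespace LayerRed

/-! ### Prefixes -/

section Prefixes
variable {α : Type*}

@[simp] theorem length_pre (p : ℕ → α) (n : ℕ) : (pre p n).length = n := by simp [pre]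

theorem pre_succ (p : ℕ → α) (n : ℕ) : pre p (n + 1) = pre p n ++ [p n] := by
  simp [pre, List.range_succ]

theorem pre_succ' (p : ℕ → α) (n : ℕ) : pre p (n + 1) = p 0 :: pre (fun k => p (k + 1)) n := by
  simp [pre, List.range_succ_eq_map, Function.comp_def]

theorem getElem?_pre (p : ℕ → α) (n k : ℕ) :
    (pre p n)[k]? = if k < n then some (p k) else none := by
  by_cases h : k < n <;> simp [pre, h]

theorem getD_pre (p : ℕ → α) {n k : ℕ} (h : k < n) (d : α) : (pre p n).getD k d = p k := by
  simp only [List.getD, getElem?_pre, h, if_true, Option.getD_some]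

theorem take_pre (p : ℕ → α) {k n : ℕ} (h : k ≤ n) : (pre p n).take k = pre p k := by
  simp [pre, ← List.map_take, List.take_range, h]

theorem pre_prefix (p : ℕ → α) {k n : ℕ} (h : k ≤ n) : pre p k <+: pre p n := by
  rw [← take_pre p h]
  exact List.take_prefix _ _

theorem map_pre {β : Type*} (f : α → β) (p : ℕ → α) (n : ℕ) :
    (pre p n).map f = pre (fun k => f (p k)) n := by
  simp [pre, Function.comp_def]

end Prefixes

/-! ### Computability of bounded search -/

section Search
variable {α : Type*} [Primcodable α]

theorem computable_any_range {n : α → ℕ} {f : α → ℕ → Bool} (hn : Computable n)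
    (hf : Computable₂ f) : Computable fun a => (List.range (n a)).any (f a) := by
  have h : Computable fun a => Nat.rec (motive := fun _ => Bool) false
      (fun k b => b || f a k) (n a) := by
    refine Computable.nat_rec hn (Computable.const false) (h := fun a q => q.2 || f a q.1) ?_
    exact (Primrec.or.to_comp).comp (Computable.snd.comp Computable.snd)
      (hf.comp Computable.fst (Computable.fst.comp Computable.snd))
  refine h.of_eq fun a => ?_
  induction n a with
  | zero => rfl
  | succ k ih => rw [List.range_succ, List.any_append, ← ih]; simp

end Search

/-! ### Open sets given by decidable sets of words -/

/-- `P i` decides a set of words, closed under extension, which generates `U i`. -/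
structure Generates (P : ℕ → List Bool → Bool) (U : ℕ → Set Cantor) : Prop where
  computable : Computable₂ P
  mono : ∀ {i u v}, u <+: v → P i u = true → P i v = true
  mem_iff : ∀ {i p}, p ∈ U i ↔ ∃ n, P i (pre p n) = true

/-- Run the enumeration for as many steps as the word is long and look for a listed prefix. A longer
word only sees more, which gives closure under extension. -/
theorem ComputableOpenSeq.exists_generates {U : ℕ → Set Cantor} (hU : ComputableOpenSeq U) :
    ∃ P, Generates P U := by
  obtain ⟨e, he, hU⟩ := hU
  let P : ℕ → List Bool → Bool := fun i v => (List.range v.length).any fun s =>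
    ((e i s).map fun w => decide (w = v.take w.length)).getD false
  have hP : ∀ i v, P i v = true ↔ ∃ s < v.length, ∃ w, e i s = some w ∧ w = v.take w.length := by
    intro i v
    simp only [P, List.any_eq_true, List.mem_range]
    refine exists_congr fun s => and_congr_right fun _ => ?_
    cases e i s <;> simp
  refine ⟨P, ?_, ?_, ?_⟩
  · refine computable_any_range (α := ℕ × List Bool)
      (f := fun a s => ((e a.1 s).map fun w => decide (w = a.2.take w.length)).getD false)
      (Computable.list_length.comp Computable.snd) ?_
    refine Computable.option_getD (Computable.option_map
      (g := fun (a : (ℕ × List Bool) × ℕ) w => decide (w = a.1.2.take w.length)) ?_ ?_)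
      (Computable.const false)
    · exact he.comp (Computable.fst.comp Computable.fst) Computable.snd
    · refine Primrec.to_comp (α := ((ℕ × List Bool) × ℕ) × List Bool) ?_
      refine PrimrecPred.decide (PrimrecRel.comp Primrec.eq Primrec.snd ?_)
      exact Primrec.list_take.comp (Primrec.list_length.comp Primrec.snd)
        (Primrec.snd.comp (Primrec.fst.comp Primrec.fst))
  · rintro i u v ⟨t, rfl⟩ h
    obtain ⟨s, hs, w, hw, hwu⟩ := (hP _ _).1 h
    refine (hP _ _).2 ⟨s, by simp; omega, w, hw, ?_⟩
    have hl : w.length ≤ u.length := by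
      have := congrArg List.length hwu
      simp at this
      omega
    rw [List.take_append_of_le_length hl]
    exact hwu
  · intro i p
    rw [hU]
    constructor
    · rintro ⟨s, w, hw, hp⟩
      refine ⟨max w.length (s + 1), (hP _ _).2 ⟨s, by simp, w, hw, ?_⟩⟩
      rw [take_pre p (le_max_left _ _)]
      exact hp
    · rintro ⟨n, hn⟩
      obtain ⟨s, -, w, hw, hwp⟩ := (hP _ _).1 hn
      refine ⟨s, w, hw, ?_⟩
      have hl : w.length ≤ n := by
        have := congrArg List.length hwp
        simp at this
        omega
      rw [take_pre p hl] at hwp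
      exact hwp

/-- Enumerate all words through `decode` and keep those that pass the test; closure under extension
is not needed. -/
theorem computableOpenSeq_of_computable {P : ℕ → List Bool → Bool} (hP : Computable₂ P) :
    ComputableOpenSeq fun i => {p | ∃ n, P i (pre p n) = true} := by
  refine ⟨fun i s => (Encodable.decode s : Option (List Bool)).bind fun w =>
    cond (P i w) (some w) none, ?_, ?_⟩
  · refine Computable.option_bind (α := ℕ × ℕ)
      (g := fun a w => cond (P a.1 w) (some w) none) (Computable.decode.comp Computable.snd) ?_
    exact Computable.cond (hP.comp (Computable.fst.comp Computable.fst) Computable.snd)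
      (Computable.option_some.comp Computable.snd) (Computable.const none)
  · intro i
    ext p
    simp only [Set.mem_ofPred_eq, Option.bind_eq_some_iff]
    constructor
    · rintro ⟨n, hn⟩
      exact ⟨Encodable.encode (pre p n), pre p n, ⟨pre p n, by simp, by simp [hn]⟩, by
        simp [IsPre]⟩
    · rintro ⟨s, w, ⟨w', -, h⟩, hp⟩
      cases hw : P i w' <;> simp [hw] at h
      subst h
      exact ⟨w'.length, by rw [← hp]; exact hw⟩

/-! ### Partial functions on Baire space computed entry by entry -/

/-- The partial function whose `j`-th output entry is the value of `φ j` on a sufficiently long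
prefix of the input. -/
noncomputable def entrywise (φ : ℕ → List ℕ → Option ℕ) : Baire →. Baire := fun p =>
  ⟨∀ j, ∃ m, (φ j (pre p m)).isSome, fun h j => (φ j (pre p (h j).choose)).get (h j).choose_spec⟩

/-- Entries computed from a word are not revised on extensions of the word. -/
def Extends (φ : ℕ → List ℕ → Option ℕ) : Prop :=
  ∀ ⦃j u v y⦄, u <+: v → φ j u = some y → φ j v = some y

section Entrywise
variable {φ : ℕ → List ℕ → Option ℕ}

theorem eq_of_entries (hmono : Extends φ) {p : Baire}
    {j m m' y y' : ℕ} (h : φ j (pre p m) = some y) (h' : φ j (pre p m') = some y') : y = y' := by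
  have h₁ := hmono (pre_prefix p (le_max_left m m')) h
  have h₂ := hmono (pre_prefix p (le_max_right m m')) h'
  exact Option.some.inj (h₁.symm.trans h₂)

theorem mem_entrywise (hmono : Extends φ)
    {p q : Baire} : q ∈ entrywise φ p ↔ ∀ j, ∃ m, φ j (pre p m) = some (q j) := by
  constructor
  · rintro ⟨h, rfl⟩ j
    exact ⟨(h j).choose, (Option.some_get _).symm⟩
  · intro h
    refine ⟨fun j => ?_, funext fun j => ?_⟩
    · obtain ⟨m, hm⟩ := h j
      exact ⟨m, by simp [hm]⟩
    · obtain ⟨m, hm⟩ := h j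
      exact eq_of_entries (j := j) hmono (Option.some_get _).symm hm

/-- The first entries, at most `n` of them, that `φ` computes from the word `u`. -/
def entries (φ : ℕ → List ℕ → Option ℕ) (u : List ℕ) (n : ℕ) : List ℕ :=
  Nat.rec [] (fun k o => cond (o.length == k) (o ++ (φ k u).toList) o) n

theorem entries_succ (u : List ℕ) (n : ℕ) : entries φ u (n + 1) =
    cond ((entries φ u n).length == n) (entries φ u n ++ (φ n u).toList) (entries φ u n) := rfl

theorem length_entries_le (u : List ℕ) (n : ℕ) : (entries φ u n).length ≤ n := by
  induction n with
  | zero => simp [entries]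
  | succ n ih =>
    rw [entries_succ]
    cases (entries φ u n).length == n <;> cases φ n u <;> simp <;> omega

theorem getElem?_entries {u : List ℕ} {n j y : ℕ} (h : (entries φ u n)[j]? = some y) :
    φ j u = some y := by
  induction n with
  | zero => simp [entries] at h
  | succ n ih =>
    rw [entries_succ] at h
    by_cases hl : (entries φ u n).length = n
    · simp only [hl, beq_self_eq_true, cond_true] at h
      rcases lt_or_ge j n with hj | hj
      · rw [List.getElem?_append_left (by omega)] at h
        exact ih h
      · rw [List.getElem?_append_right (by omega), hl] at h
        cases hφ : φ n u with
        | none => simp [hφ] at h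
        | some z =>
          rw [hφ] at h
          have : j - n = 0 := by
            by_contra hne
            rw [List.getElem?_eq_none (by simp; omega)] at h
            simp at h
          have hjn : j = n := by omega
          subst hjn
          simpa [hφ] using h
    · have : ((entries φ u n).length == n) = false := by simpa using hl
      rw [this] at h
      exact ih h

theorem le_length_entries {u : List ℕ} {n k : ℕ} (hk : k ≤ n) (h : ∀ j < k, (φ j u).isSome) :
    k ≤ (entries φ u n).length := by
  have key : ∀ k, (∀ j < k, (φ j u).isSome) → (entries φ u k).length = k := by
    intro k
    induction k with
    | zero => intro _; simp [entries]
    | succ k ih =>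
      intro h
      obtain ⟨y, hy⟩ := Option.isSome_iff_exists.1 (h k (by omega))
      have := ih fun j hj => h j (by omega)
      rw [entries_succ]
      simp [this, hy]
  induction n, hk using Nat.le_induction with
  | base => exact (key k h).ge
  | succ n _ ih =>
    refine ih.trans ?_
    rw [entries_succ]
    cases (entries φ u n).length == n <;> simp

theorem computable_entries (hφ : Computable₂ φ) : Computable₂ (entries φ) := by
  refine Computable.nat_rec (α := List ℕ × ℕ) (f := Prod.snd) (g := fun _ => [])
    (h := fun a q => cond (q.2.length == q.1) (q.2 ++ (φ q.1 a.1).toList) q.2)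
    Computable.snd (Computable.const []) ?_
  have hq : Computable fun x : (List ℕ × ℕ) × (ℕ × List ℕ) => x.2.2 :=
    Computable.snd.comp Computable.snd
  have hk : Computable fun x : (List ℕ × ℕ) × (ℕ × List ℕ) => x.2.1 :=
    Computable.fst.comp Computable.snd
  refine Computable.cond ?_ ?_ hq
  · exact (Primrec.beq.to_comp).comp (Computable.list_length.comp hq) hk
  · exact Computable.list_append.comp hq ((Primrec.optionToList.to_comp).comp
      (hφ.comp hk (Computable.fst.comp Computable.fst)))

/-- On input `u`, output entries until one is missing, and at most `u.length` of them. Since entries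
are never revised, these outputs grow with `u`. -/
theorem computableBaire_entrywise (hφ : Computable₂ φ)
    (hmono : Extends φ) :
    ComputableBaire (entrywise φ) := by
  have hget : ∀ {u n j}, j < (entries φ u n).length → (φ j u).isSome := by
    intro u n j hj
    rw [getElem?_entries (List.getElem?_eq_getElem hj)]
    rfl
  refine ⟨fun u => entries φ u u.length, ?_, ?_, ?_⟩
  · exact (computable_entries hφ).comp Computable.id Computable.list_length
  · intro u v huv
    have hlen : (entries φ u u.length).length ≤ (entries φ v v.length).length := by
      refine le_length_entries ((length_entries_le _ _).trans huv.length_le) fun j hj => ?_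
      obtain ⟨y, hy⟩ := Option.isSome_iff_exists.1 (hget hj)
      rw [hmono huv hy]
      rfl
    rw [List.prefix_iff_getElem?]
    intro j hj
    have h₁ := hmono huv (getElem?_entries (List.getElem?_eq_getElem hj))
    have h₂ := getElem?_entries (List.getElem?_eq_getElem (hj.trans_le hlen))
    rw [List.getElem?_eq_getElem (hj.trans_le hlen), ← h₂, h₁]
  · intro p q hq
    rw [mem_entrywise hmono] at hq
    constructor
    · intro m
      refine List.ext_getElem (by simp) fun j h₁ h₂ => ?_
      have h := getElem?_entries (List.getElem?_eq_getElem h₁)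
      obtain ⟨m', hm'⟩ := hq j
      rw [eq_of_entries hmono h hm']
      simp [pre]
    · intro n
      choose m hm using hq
      -- Length `n` permits `n` entries; the supremum makes all of the first `n` available.
      refine ⟨max n ((Finset.range n).sup m), le_length_entries (by simp) fun j hj => ?_⟩
      rw [hmono (pre_prefix p (le_max_of_le_right (Finset.le_sup (Finset.mem_range.2 hj)))) (hm j)]
      rfl

end Entrywise

/-! ### The fair-coin measure -/

instance : IsProbabilityMeasure lebesgue := by unfold lebesgue; infer_instance

theorem coin_singleton (b : Bool) : coin {b} = 2⁻¹ := by
  rw [coin, PMF.toMeasure_apply_singleton _ _ (MeasurableSet.singleton b)]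
  simp [PMF.uniformOfFintype_apply]

theorem coin_eq : coin = (2⁻¹ : ℝ≥0∞) • (Measure.dirac false + Measure.dirac true) := by
  refine Measure.ext_of_singleton fun b => ?_
  rw [coin_singleton]
  cases b <;> simp

theorem measurableSet_pre (n : ℕ) (S : List Bool → Prop) :
    MeasurableSet {p : Cantor | S (pre p n)} := by
  have hf : Measurable fun (p : Cantor) (i : Fin n) => p i :=
    measurable_pi_lambda _ fun i => measurable_pi_apply _
  have : {p : Cantor | S (pre p n)} =
      (fun (p : Cantor) (i : Fin n) => p i) ⁻¹' {f | S (List.ofFn f)} := by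
    ext p
    have : pre p n = List.ofFn fun i : Fin n => p i := by
      refine List.ext_getElem (by simp) fun i h₁ h₂ => by simp [pre]
    simp [this]
  rw [this]
  exact hf (Set.toFinite _).measurableSet

theorem Generates.measurableSet {P : ℕ → List Bool → Bool} {U : ℕ → Set Cantor}
    (h : Generates P U) (i : ℕ) : MeasurableSet (U i) := by
  have : U i = ⋃ n, {p | P i (pre p n) = true} := by
    ext p
    simp [h.mem_iff]
  rw [this]
  exact MeasurableSet.iUnion fun n => measurableSet_pre n fun w => P i w = true

/-- The sequence with first entry `b` and then the entries of `p`. -/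
def cons (b : Bool) (p : Cantor) : Cantor := fun n => Nat.casesOn n b p

theorem measurable_cons (b : Bool) : Measurable (cons b) := by
  refine measurable_pi_lambda _ fun n => ?_
  cases n with
  | zero => exact measurable_const
  | succ n => exact measurable_pi_apply n

theorem pre_cons (b : Bool) (p : Cantor) (n : ℕ) : pre (cons b p) (n + 1) = b :: pre p n :=
  pre_succ' _ _

theorem lebesgue_pi_range (n : ℕ) (t : ℕ → Set Bool) :
    lebesgue (((Finset.range n : Finset ℕ) : Set ℕ).pi t) = ∏ i ∈ Finset.range n, coin (t i) :=
  Measure.infinitePi_pi _ fun _ _ => (Set.toFinite _).measurableSet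

theorem cons_preimage_pi (b : Bool) (n : ℕ) (t : ℕ → Set Bool) :
    lebesgue (cons b ⁻¹' ((Finset.range (n + 1) : Finset ℕ) : Set ℕ).pi t) =
      Measure.dirac b (t 0) * ∏ i ∈ Finset.range n, coin (t (i + 1)) := by
  by_cases hb : b ∈ t 0
  · have : cons b ⁻¹' ((Finset.range (n + 1) : Finset ℕ) : Set ℕ).pi t =
        ((Finset.range n : Finset ℕ) : Set ℕ).pi fun i => t (i + 1) := by
      ext p
      simp only [Set.mem_preimage, Set.mem_pi, Finset.coe_range, Set.mem_Iio]
      constructor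
      · intro h i hi
        exact h (i + 1) (by omega)
      · intro h i hi
        cases i with
        | zero => exact hb
        | succ i => exact h i (by omega)
    rw [this, lebesgue_pi_range, Measure.dirac_apply]
    simp [hb]
  · have : cons b ⁻¹' ((Finset.range (n + 1) : Finset ℕ) : Set ℕ).pi t = ∅ := by
      ext p
      simp only [Set.mem_preimage, Set.mem_pi, Finset.coe_range, Set.mem_Iio,
        Set.mem_empty_iff_false, iff_false, not_forall]
      exact ⟨0, by omega, hb⟩
    rw [this, Measure.dirac_apply]
    simp [hb]

/-- The product measure is determined by its values on boxes, and on a box the factor at position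
`0` splits off. -/
theorem lebesgue_eq_cons : lebesgue =
    (2⁻¹ : ℝ≥0∞) • (lebesgue.map (cons false) + lebesgue.map (cons true)) := by
  symm
  refine Measure.eq_infinitePi _ fun s t ht => ?_
  classical
  obtain ⟨n, hn⟩ : ∃ n, s ⊆ Finset.range (n + 1) :=
    ⟨s.sup id, fun i hi => Finset.mem_range.2 (Nat.lt_succ_of_le (Finset.le_sup (f := id) hi))⟩
  -- Padding with full factors turns the index set into an initial segment without changing the box.
  let t' : ℕ → Set Bool := fun i => if i ∈ s then t i else Set.univ
  have h₁ : (s : Set ℕ).pi t = ((Finset.range (n + 1) : Finset ℕ) : Set ℕ).pi t' := by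
    ext p
    simp only [Set.mem_pi, Finset.mem_coe, t']
    constructor
    · intro h i _
      split_ifs with his
      · exact h i his
      · trivial
    · intro h i hi
      simpa [hi] using h i (hn hi)
  have h₂ : ∏ i ∈ s, coin (t i) = ∏ i ∈ Finset.range (n + 1), coin (t' i) := by
    rw [← Finset.prod_subset hn (f := fun i => coin (t' i))]
    · exact Finset.prod_congr rfl fun i hi => by simp [t', hi]
    · intro i _ hi
      simp only [t', hi, if_false]
      exact measure_univ
  have hm : MeasurableSet (((Finset.range (n + 1) : Finset ℕ) : Set ℕ).pi t') :=
    MeasurableSet.pi (Set.to_countable _) fun i _ => (Set.toFinite _).measurableSet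
  rw [h₁, h₂, Measure.smul_apply, Measure.add_apply, Measure.map_apply (measurable_cons _) hm,
    Measure.map_apply (measurable_cons _) hm, cons_preimage_pi, cons_preimage_pi,
    Finset.prod_range_succ', coin_eq, Measure.smul_apply, Measure.add_apply, ← add_mul,
    smul_eq_mul, smul_eq_mul, ← mul_assoc, mul_comm]

/-- The self-similarity of the fair-coin measure. -/
theorem lebesgue_apply_cons {A : Set Cantor} (hA : MeasurableSet A) :
    lebesgue A = 2⁻¹ * (lebesgue (cons false ⁻¹' A) + lebesgue (cons true ⁻¹' A)) := by
  conv_lhs => rw [lebesgue_eq_cons]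
  rw [Measure.smul_apply, Measure.add_apply, Measure.map_apply (measurable_cons _) hA,
    Measure.map_apply (measurable_cons _) hA, smul_eq_mul]

/-- **Ville's inequality** for nonnegative supermartingales on finite words. -/
theorem lebesgue_exists_one_le {f : List Bool → ℝ≥0∞}
    (hf : ∀ w, f (w ++ [false]) + f (w ++ [true]) ≤ 2 * f w) :
    lebesgue {p | ∃ n, 1 ≤ f (pre p n)} ≤ f [] := by
  have hmeas : ∀ (f : List Bool → ℝ≥0∞) n,
      MeasurableSet {p : Cantor | ∃ k ≤ n, 1 ≤ f (pre p k)} := by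
    intro f n
    have : {p : Cantor | ∃ k ≤ n, 1 ≤ f (pre p k)} = ⋃ k ∈ Set.Iic n, {p | 1 ≤ f (pre p k)} := by
      ext p
      simp
    rw [this]
    exact MeasurableSet.biUnion (Set.to_countable _) fun k _ => measurableSet_pre k fun w => 1 ≤ f w
  -- The induction varies `f`: after the first bit `b` it is applied to the supermartingale `w ↦ f
  -- (b :: w)`.
  have key : ∀ n (f : List Bool → ℝ≥0∞),
      (∀ w, f (w ++ [false]) + f (w ++ [true]) ≤ 2 * f w) →
      lebesgue {p | ∃ k ≤ n, 1 ≤ f (pre p k)} ≤ f [] := by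
    intro n
    induction n with
    | zero =>
      intro f _
      by_cases h : 1 ≤ f []
      · exact prob_le_one.trans h
      · have : {p : Cantor | ∃ k ≤ 0, 1 ≤ f (pre p k)} = ∅ := by
          ext p
          simpa [pre] using h
        rw [this, measure_empty]
        exact zero_le
    | succ n ih =>
      intro f hf
      by_cases h : 1 ≤ f []
      · exact prob_le_one.trans h
      have hpre : ∀ b, cons b ⁻¹' {p | ∃ k ≤ n + 1, 1 ≤ f (pre p k)} =
          {p | ∃ k ≤ n, 1 ≤ f (b :: pre p k)} := by
        intro b
        ext p
        simp only [Set.mem_preimage, Set.mem_ofPred_eq]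
        constructor
        · rintro ⟨k, hk, hfk⟩
          cases k with
          | zero => exact absurd (by simpa [pre] using hfk) h
          | succ k => exact ⟨k, by omega, by rwa [pre_cons] at hfk⟩
        · rintro ⟨k, hk, hfk⟩
          exact ⟨k + 1, by omega, by rwa [pre_cons]⟩
      have hb : ∀ b, lebesgue {p | ∃ k ≤ n, 1 ≤ f (b :: pre p k)} ≤ f [b] := fun b =>
        ih (fun w => f (b :: w)) fun w => by simpa using hf (b :: w)
      rw [lebesgue_apply_cons (hmeas f _), hpre, hpre]
      calc 2⁻¹ * (lebesgue _ + lebesgue _) ≤ 2⁻¹ * (2 * f []) := by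
            gcongr
            exact (add_le_add (hb false) (hb true)).trans (hf [])
        _ = f [] := by
            rw [← mul_assoc, ENNReal.inv_mul_cancel (by simp) (by simp), one_mul]
  have hU : {p | ∃ n, 1 ≤ f (pre p n)} = ⋃ n, {p : Cantor | ∃ k ≤ n, 1 ≤ f (pre p k)} := by
    ext p
    simp only [Set.mem_ofPred_eq, Set.mem_iUnion]
    exact ⟨fun ⟨n, hn⟩ => ⟨n, n, le_rfl, hn⟩, fun ⟨_, k, _, hk⟩ => ⟨k, hk⟩⟩
  rw [hU, Monotone.measure_iUnion]
  · exact iSup_le fun n => key n f hf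
  · intro m n hmn p
    rintro ⟨k, hk, h⟩
    exact ⟨k, hk.trans hmn, h⟩

/-! ### Closure properties of Martin-Löf randomness -/

/-- The unions of the tails of a sequence of sets. -/
def tail (E : ℕ → Set Cantor) (i : ℕ) : Set Cantor := ⋃ j, E (i + j)

theorem computableOpenSeq_tail {E : ℕ → Set Cantor} (hE : ComputableOpenSeq E) :
    ComputableOpenSeq (tail E) := by
  obtain ⟨e, he, hE⟩ := hE
  refine ⟨fun i s => e (i + s.unpair.1) s.unpair.2, ?_, fun i => ?_⟩
  · refine he.comp (α := ℕ × ℕ) ?_ ?_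
    · exact (Primrec.nat_add.to_comp).comp Computable.fst
        (Computable.fst.comp (Computable.unpair.comp Computable.snd))
    · exact Computable.snd.comp (Computable.unpair.comp Computable.snd)
  · ext p
    simp only [tail, hE, Set.mem_iUnion, Set.mem_ofPred_eq]
    constructor
    · rintro ⟨j, s, h⟩
      exact ⟨Nat.pair j s, by simpa using h⟩
    · rintro ⟨s, h⟩
      exact ⟨_, _, h⟩

/-- The exponent `i + 1` leaves room for the geometric series over the tail. -/
theorem isMLTest_tail {E : ℕ → Set Cantor} (hE : ComputableOpenSeq E)
    (hlE : ∀ i, lebesgue (E i) ≤ (2⁻¹ : ℝ≥0∞) ^ (i + 1)) : IsMLTest (tail E) := by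
  refine ⟨computableOpenSeq_tail hE, fun i => ?_⟩
  calc lebesgue (tail E i) ≤ ∑' j, lebesgue (E (i + j)) := measure_iUnion_le _
    _ ≤ ∑' j : ℕ, (2⁻¹ : ℝ≥0∞) ^ (i + 1) * (2⁻¹ : ℝ≥0∞) ^ j :=
        ENNReal.tsum_le_tsum fun j => (hlE _).trans_eq (by rw [← pow_add]; congr 1; omega)
    _ = (2⁻¹ : ℝ≥0∞) ^ i := by
        rw [ENNReal.tsum_mul_left, ENNReal.tsum_geometric, ENNReal.one_sub_inv_two, inv_inv,
          pow_succ, mul_assoc, ENNReal.inv_mul_cancel (by simp) (by simp), mul_one]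

/-- An effective Borel–Cantelli lemma: avoiding one tail union means avoiding all later sets. -/
theorem exists_forall_notMem_of_mem_MLR {E : ℕ → Set Cantor} (hE : ComputableOpenSeq E)
    (hlE : ∀ i, lebesgue (E i) ≤ (2⁻¹ : ℝ≥0∞) ^ (i + 1)) {p : Cantor} (hp : p ∈ MLR) :
    ∃ i, ∀ j ≥ i, p ∉ E j := by
  have h := hp _ (isMLTest_tail hE hlE)
  simp only [Set.mem_iInter, not_forall] at h
  obtain ⟨i, hi⟩ := h
  refine ⟨i, fun j hj hjp => hi (Set.mem_iUnion.2 ⟨j - i, ?_⟩)⟩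
  rwa [Nat.add_sub_cancel' hj]

theorem IsMLTest.exists_forall_notMem {U : ℕ → Set Cantor} (hU : IsMLTest U) {p : Cantor}
    (hp : p ∈ MLR) : ∃ i, ∀ j ≥ i, p ∉ U j := by
  obtain ⟨e, he, hUe⟩ := hU.1
  -- Shifting the index gains the factor `1/2` that the tail unions require.
  have hE : ComputableOpenSeq fun i => U (i + 1) :=
    ⟨fun i s => e (i + 1) s, he.comp (α := ℕ × ℕ) (Computable.succ.comp Computable.fst)
      Computable.snd, fun i => hUe (i + 1)⟩
  obtain ⟨i, hi⟩ := exists_forall_notMem_of_mem_MLR hE (fun i => hU.2 (i + 1)) hp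
  refine ⟨i + 1, fun j hj => ?_⟩
  have := hi (j - 1) (by omega)
  rwa [Nat.sub_add_cancel (by omega)] at this

/-- The sequence `p` with the bit at position `m` changed. -/
def flip (m : ℕ) (p : Cantor) : Cantor := fun n => xor (p n) (decide (n = m))

theorem measurePreserving_flip (m : ℕ) : MeasurePreserving (flip m) lebesgue lebesgue := by
  refine ⟨measurable_pi_lambda _ fun n => (measurable_of_countable
    fun b => xor b (decide (n = m))).comp (measurable_pi_apply n), ?_⟩
  have h := Measure.infinitePi_map_pi (fun _ : ℕ => coin)
    (f := fun n b => xor b (decide (n = m))) fun n => measurable_of_countable _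
  refine h.trans ?_
  have : (fun n : ℕ => coin.map fun b => xor b (decide (n = m))) = fun _ => coin := by
    funext n
    refine Measure.ext_of_singleton fun b => ?_
    rw [Measure.map_apply (measurable_of_countable _) (MeasurableSet.singleton b)]
    have : (fun c => xor c (decide (n = m))) ⁻¹' {b} = {xor b (decide (n = m))} := by
      ext c
      cases b <;> cases c <;> cases decide (n = m) <;> simp
    rw [this, coin_singleton, coin_singleton]
  simp only [this, lebesgue]

/-- The word `w` with the bit at position `m` changed. -/
def flipWord (m : ℕ) (w : List Bool) : List Bool :=
  (List.range w.length).map fun n => xor (w.getD n false) (decide (n = m))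

theorem flipWord_pre (m : ℕ) (p : Cantor) (n : ℕ) : flipWord m (pre p n) = pre (flip m p) n := by
  rw [flipWord, length_pre]
  refine List.map_congr_left fun k hk => ?_
  rw [getD_pre p (List.mem_range.1 hk)]
  rfl

theorem primrec_flipWord (m : ℕ) : Primrec (flipWord m) := by
  refine Primrec.list_map (g := fun (w : List Bool) n => xor (w.getD n false) (decide (n = m)))
    (Primrec.list_range.comp Primrec.list_length) ?_
  refine (Primrec.dom_bool₂ xor).comp (α := List Bool × ℕ)
    ((Primrec.list_getD false).comp Primrec.fst Primrec.snd) ?_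
  exact PrimrecPred.decide (PrimrecRel.comp Primrec.eq Primrec.snd (Primrec.const m))

/-- Changing one bit is computable and preserves the measure, so it pulls tests back to tests. -/
theorem flip_mem_MLR {p : Cantor} (hp : p ∈ MLR) (m : ℕ) : flip m p ∈ MLR := by
  intro V hV hpV
  obtain ⟨P, hP⟩ := hV.1.exists_generates
  have hV' : ∀ i, flip m ⁻¹' V i = {p | ∃ n, P i (flipWord m (pre p n)) = true} := by
    intro i
    ext p
    simp only [Set.mem_preimage, hP.mem_iff, flipWord_pre, Set.mem_ofPred_eq]
  refine hp (fun i => flip m ⁻¹' V i) ⟨?_, fun i => ?_⟩ ?_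
  · simp only [hV']
    exact computableOpenSeq_of_computable (P := fun i w => P i (flipWord m w))
      (hP.computable.comp (α := ℕ × List Bool) Computable.fst
        ((primrec_flipWord m).to_comp.comp Computable.snd))
  · rw [(measurePreserving_flip m).measure_preimage (hP.measurableSet i).nullMeasurableSet]
    exact hV.2 i
  · simpa using hpV

theorem mem_MLR_of_forall_ge_eq {p q : Cantor} (hp : p ∈ MLR) {N : ℕ} (h : ∀ n ≥ N, q n = p n) :
    q ∈ MLR := by
  induction N generalizing p with
  | zero =>
    have : q = p := funext fun n => h n (Nat.zero_le n)
    rwa [this]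
  | succ N ih =>
    by_cases hN : q N = p N
    · refine ih hp fun n hn => ?_
      rcases eq_or_lt_of_le hn with rfl | hn
      · exact hN
      · exact h n hn
    · refine ih (flip_mem_MLR hp N) fun n hn => ?_
      rcases eq_or_lt_of_le hn with rfl | hn
      · cases hq : q N <;> cases hp : p N <;> simp_all [flip]
      · simp [flip, hn.ne', h n hn]

theorem lebesgue_pre_eq_zeros (i : ℕ) :
    lebesgue {p | pre p i = pre (fun _ => false) i} = (2⁻¹ : ℝ≥0∞) ^ i := by
  have : {p : Cantor | pre p i = pre (fun _ => false) i} =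
      ((Finset.range i : Finset ℕ) : Set ℕ).pi fun _ => {false} := by
    ext p
    simp [pre, Set.mem_pi, -List.map_const', -List.map_const]
  rw [this, lebesgue_pi_range]
  simp [coin_singleton]

/-- The cylinders around the zero sequence form a test that catches it. -/
theorem zeros_notMem_MLR : (fun _ => false : Cantor) ∉ MLR := by
  intro h
  have hV : ∀ i, {p : Cantor | pre p i = pre (fun _ => false) i} =
      {p | ∃ n, decide (pre p n = pre (fun _ => false) i) = true} := by
    intro i
    ext p
    simp only [Set.mem_ofPred_eq, decide_eq_true_eq]
    refine ⟨fun h => ⟨i, h⟩, fun ⟨n, hn⟩ => ?_⟩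
    have : n = i := by simpa using congrArg List.length hn
    rwa [this] at hn
  refine h (fun i => {p : Cantor | pre p i = pre (fun _ => false) i})
    ⟨?_, fun i => (lebesgue_pre_eq_zeros i).le⟩ (by simp)
  simp only [hV]
  refine computableOpenSeq_of_computable
    (P := fun i w => decide (w = pre (fun _ => false) i)) ?_
  refine Primrec.to_comp (α := ℕ × List Bool) ?_
  refine PrimrecPred.decide (PrimrecRel.comp Primrec.eq Primrec.snd ?_)
  exact Primrec.list_map (g := fun _ _ => false) (Primrec.list_range.comp Primrec.fst)
    (Primrec.const false)

theorem notMem_MLR_of_eventually_false {p : Cantor} {N : ℕ} (h : ∀ n ≥ N, p n = false) :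
    p ∉ MLR := fun hp =>
  zeros_notMem_MLR (mem_MLR_of_forall_ge_eq hp (N := N) fun n hn => (h n hn).symm)

theorem IsUniversalMLTest.mem_of_notMem_MLR {U : ℕ → Set Cantor} (hU : IsUniversalMLTest U)
    {p : Cantor} (hp : p ∉ MLR) (i : ℕ) : p ∈ U i := by
  rw [MLR_eq_compl hU, Set.mem_compl_iff, not_not] at hp
  exact Set.mem_iInter.1 hp i

/-! ### Overwriting bits of a sequence by zeros -/

section Overwrite

/-- The first `n` bits obtained from the word `w` by replacing the bit at position `k` with `0`
whenever `ow u v` holds for the words `u`, `v` of length `k` read and written before. -/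
def overwriteWord (ow : List Bool → List Bool → Bool) (w : List Bool) (n : ℕ) : List Bool :=
  Nat.rec [] (fun k o => o ++ [!ow (w.take k) o && w.getD k false]) n

/-- The sequence obtained from `p` by replacing the bit at position `k` with `0` whenever `ow u v`
holds for the words `u`, `v` of length `k` read and written before. -/
def overwrite (ow : List Bool → List Bool → Bool) (p : Cantor) : Cantor := fun n =>
  !ow (pre p n) (overwriteWord ow (pre p n) n) && p n

variable {ow : List Bool → List Bool → Bool}

theorem overwriteWord_pre (p : Cantor) {k n : ℕ} (h : k ≤ n) :
    overwriteWord ow (pre p n) k = pre (overwrite ow p) k := by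
  induction k generalizing n with
  | zero => rfl
  | succ k ih =>
    have : overwriteWord ow (pre p n) (k + 1) = overwriteWord ow (pre p n) k ++
      [!ow ((pre p n).take k) (overwriteWord ow (pre p n) k) && (pre p n).getD k false] := rfl
    rw [this, pre_succ, take_pre p (by omega), getD_pre p (by omega), ih (by omega), overwrite,
      ih le_rfl]

theorem overwrite_apply (p : Cantor) (n : ℕ) :
    overwrite ow p n = (!ow (pre p n) (pre (overwrite ow p) n) && p n) := by
  conv_lhs => rw [overwrite, overwriteWord_pre p le_rfl]

theorem computable_overwriteWord (h : Computable₂ ow) : Computable₂ (overwriteWord ow) := by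
  refine Computable.nat_rec (α := List Bool × ℕ) (f := Prod.snd) (g := fun _ => [])
    (h := fun a q => q.2 ++ [!ow (a.1.take q.1) q.2 && a.1.getD q.1 false])
    Computable.snd (Computable.const []) ?_
  have hw : Primrec fun x : (List Bool × ℕ) × (ℕ × List Bool) => x.1.1 :=
    Primrec.fst.comp Primrec.fst
  have hk : Primrec fun x : (List Bool × ℕ) × (ℕ × List Bool) => x.2.1 :=
    Primrec.fst.comp Primrec.snd
  have ho : Primrec fun x : (List Bool × ℕ) × (ℕ × List Bool) => x.2.2 :=
    Primrec.snd.comp Primrec.snd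
  refine Computable.list_concat.comp ho.to_comp ?_
  refine (Primrec.and.to_comp).comp ((Primrec.not.to_comp).comp ?_) ?_
  · exact h.comp (Primrec.list_take.comp hk hw).to_comp ho.to_comp
  · exact ((Primrec.list_getD false).comp hw hk).to_comp

/-- The entries of a name of `overwrite ow p`, computed from a name of `p`. -/
def overwriteEntry (ow : List Bool → List Bool → Bool) (j : ℕ) (u : List ℕ) : Option ℕ :=
  -- The guard matters: `overwriteWord` reads bits beyond the end of its word as `false`, so an
  -- unguarded entry could be revised later.
  cond (decide (j < u.length))
    (((overwriteWord ow (u.map fun k => !(k == 0)) (j + 1))[j]?).map fun b => cond b 1 0) none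

theorem computable_overwriteEntry (h : Computable₂ ow) : Computable₂ (overwriteEntry ow) := by
  refine Computable.cond (α := ℕ × List ℕ) ?_ ?_ (Computable.const none)
  · exact (PrimrecPred.decide (PrimrecRel.comp Primrec.nat_lt Primrec.fst
      (Primrec.list_length.comp Primrec.snd))).to_comp
  · refine Computable.option_map (g := fun _ b => cond b 1 0) ?_
      ((Primrec.dom_bool fun b => cond b 1 0).to_comp.comp Computable.snd)
    refine Computable.list_getElem?.comp ?_ Computable.fst
    refine (computable_overwriteWord h).comp ?_ (Computable.succ.comp Computable.fst)
    exact (Primrec.list_map (g := fun _ k => !(k == 0)) Primrec.snd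
      (Primrec.not.comp (Primrec.beq.comp Primrec.snd (Primrec.const 0)))).to_comp

theorem overwriteEntry_pre (q : Baire) (j m : ℕ) : overwriteEntry ow j (pre q m) =
    if j < m then some (overwrite ow (fun k => !(q k == 0)) j).toNat else none := by
  by_cases h : j < m
  · have h' : j + 1 ≤ m := h
    rw [overwriteEntry, map_pre, overwriteWord_pre _ h', getElem?_pre]
    simp [h, Bool.toNat]
  · simp [overwriteEntry, h]

theorem exists_eq_pre (v : List ℕ) : ∃ q : Baire, ∀ u, u <+: v → u = pre q u.length := by
  refine ⟨fun k => v.getD k 0, ?_⟩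
  rintro u ⟨t, rfl⟩
  refine List.ext_getElem (by simp) fun i h₁ h₂ => ?_
  simp [pre, List.getD, List.getElem?_append_left h₁, List.getElem?_eq_getElem h₁]

/-- Padding a word with zeros makes all its prefixes prefixes of one sequence, so it is enough to
check along sequences. -/
theorem extends_of_pre {φ : ℕ → List ℕ → Option ℕ}
    (h : ∀ q j m m' y, m ≤ m' → φ j (pre q m) = some y → φ j (pre q m') = some y) :
    Extends φ := by
  intro j u v y huv hu
  obtain ⟨q, hq⟩ := exists_eq_pre v
  rw [hq u huv] at hu
  rw [hq v List.prefix_rfl]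
  exact h q j _ _ y huv.length_le hu

theorem extends_overwriteEntry : Extends (overwriteEntry ow) := by
  refine extends_of_pre fun q j m m' y hm h => ?_
  rw [overwriteEntry_pre] at h ⊢
  split_ifs at h with hj
  rw [if_pos (hj.trans_le hm), h]

/-- Overwriting, as a computable function on names. -/
theorem mem_entrywise_overwriteEntry {q : Baire} {p : Cantor} (h : Represented.IsName q p) :
    (fun n => (overwrite ow p n).toNat) ∈ entrywise (overwriteEntry ow) q := by
  have hq : (fun k => !(q k == 0)) = p := by
    funext k
    have : q k = (p k).toNat := h k
    rw [this]
    cases p k <;> rfl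
  refine (mem_entrywise extends_overwriteEntry).2 fun j => ⟨j + 1, ?_⟩
  rw [overwriteEntry_pre, hq]
  simp

theorem overwrite_mem_MLR {p : Cantor} (hp : p ∈ MLR)
    (h : ∀ᶠ n in atTop, ow (pre p n) (pre (overwrite ow p) n) = false) :
    overwrite ow p ∈ MLR := by
  obtain ⟨N, hN⟩ := eventually_atTop.1 h
  refine mem_MLR_of_forall_ge_eq hp (N := N) fun n hn => ?_
  rw [overwrite_apply, hN n hn]
  simp

/-- Overwrite as long as some `i` is seen with `P i` true and `Q i` false. -/
def demand (P : ℕ → List Bool → Bool) (Q : ℕ → List Bool → List Bool → Bool)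
    (u v : List Bool) : Bool :=
  (List.range u.length).any fun i => P i u && !Q i u v

theorem computable_demand {P : ℕ → List Bool → Bool} {Q : ℕ → List Bool → List Bool → Bool}
    (hP : Computable₂ P)
    (hQ : Computable fun x : ℕ × List Bool × List Bool => Q x.1 x.2.1 x.2.2) :
    Computable₂ (demand P Q) := by
  refine computable_any_range (α := List Bool × List Bool)
    (f := fun a i => P i a.1 && !Q i a.1 a.2) (Computable.list_length.comp Computable.fst) ?_
  refine (Primrec.and.to_comp).comp (α := (List Bool × List Bool) × ℕ)
    (hP.comp Computable.snd (Computable.fst.comp Computable.fst)) ((Primrec.not.to_comp).comp ?_)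
  exact hQ.comp (Computable.pair Computable.snd Computable.fst)

/-- If `p` lies in only finitely many of the sets generated by `P`, then overwriting `p` until
`Q i` holds, for every `i` with `p ∈ V i`, changes only finitely many bits. -/
theorem overwrite_demand {P : ℕ → List Bool → Bool} {V : ℕ → Set Cantor} (hP : Generates P V)
    {Q : ℕ → List Bool → List Bool → Bool} {p r : Cantor} (hr : r = overwrite (demand P Q) p)
    (hp : p ∈ MLR) (hfin : ∃ i, ∀ j ≥ i, p ∉ V j)
    (hQ : ∀ i n m, n ≤ m → Q i (pre p n) (pre r n) = true → Q i (pre p m) (pre r m) = true)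
    (hforce : ∀ i, (∀ᶠ n in atTop, r n = false) → ∃ n, Q i (pre p n) (pre r n) = true) :
    r ∈ MLR ∧ ∀ i, p ∈ V i → ∃ n, Q i (pre p n) (pre r n) = true := by
  have hsat : ∀ i, p ∈ V i → ∃ n, Q i (pre p n) (pre r n) = true := by
    intro i hi
    by_contra hne
    push Not at hne
    obtain ⟨n, hn⟩ := hP.mem_iff.1 hi
    -- An unmet demand would zero every later bit, and then `hforce` meets it. From `n` on the
    -- demand has been raised; from `i + 1` on it lies in the range that `demand` inspects.
    obtain ⟨m, hm⟩ := hforce i <| eventually_atTop.2 ⟨max n (i + 1), fun k hk => by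
      have : demand P Q (pre p k) (pre r k) = true := by
        simp only [demand, List.any_eq_true, List.mem_range, length_pre]
        refine ⟨i, by omega, ?_⟩
        rw [hP.mono (pre_prefix p (by omega)) hn]
        simpa using hne k
      rw [hr, overwrite_apply, ← hr, this]
      rfl⟩
    exact hne m hm
  refine ⟨?_, hsat⟩
  obtain ⟨i₀, hi₀⟩ := hfin
  have hev : ∀ i, ∀ᶠ n in atTop, (P i (pre p n) && !Q i (pre p n) (pre r n)) = false := by
    intro i
    by_cases hi : p ∈ V i
    · obtain ⟨n, hn⟩ := hsat i hi
      filter_upwards [eventually_ge_atTop n] with m hm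
      simp [hQ i n m hm hn]
    · refine Eventually.of_forall fun n => ?_
      have : P i (pre p n) = false := by
        by_contra h
        exact hi (hP.mem_iff.2 ⟨n, by simpa using h⟩)
      simp [this]
  rw [hr]
  refine overwrite_mem_MLR hp ?_
  rw [← hr]
  -- Only the finitely many demands below `i₀` can ever be raised, and each is eventually quiet.
  filter_upwards [(Finset.eventually_all (Finset.range i₀)).2 fun i _ => hev i] with n hn
  rw [demand, List.any_eq_false]
  intro i _
  rcases lt_or_ge i i₀ with h | h
  · simp [hn i (Finset.mem_range.2 h)]
  · have : P i (pre p n) = false := by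
      by_contra h'
      exact hi₀ i h (hP.mem_iff.2 ⟨n, by simpa using h'⟩)
    simp [this]

end Overwrite

/-! ### Random harmonic series: computing the partial sums -/

theorem harmonicPartial_succ (p : Cantor) (N : ℕ) : harmonicPartial p (N + 1) =
    harmonicPartial p N + (-1 : ℝ) ^ (p (N + 1)).toNat / ((N + 1 : ℕ) : ℝ) := by
  rw [harmonicPartial, Finset.sum_Icc_succ_top (by omega), harmonicPartial]

/-- `N!` times the sum of the `1 / n` with `M < n ≤ N` such that the word `w` has the bit `β` at
position `n`. -/
def numer (β : Bool) (M : ℕ) (w : List Bool) (N : ℕ) : ℕ :=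
  Nat.rec 0 (fun k a => a * (k + 1) +
    cond ((w.getD (k + 1) false == β) && decide (M ≤ k)) k.factorial 0) N

theorem numer_succ (β : Bool) (M : ℕ) (w : List Bool) (N : ℕ) : numer β M w (N + 1) =
    numer β M w N * (N + 1) +
      cond ((w.getD (N + 1) false == β) && decide (M ≤ N)) N.factorial 0 := rfl

/-- Clearing denominators by `N!` and separating the signs lets natural number arithmetic decide
inequalities between partial sums. The bound on `N` ensures that the prefix contains every bit used.
-/
theorem numer_sub_numer (p : Cantor) (M : ℕ) {m N : ℕ} (h : N ≤ m - 1) :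
    (numer false M (pre p m) N : ℝ) - numer true M (pre p m) N =
      (harmonicPartial p N - harmonicPartial p (min M N)) * N.factorial := by
  induction N with
  | zero => simp [numer]
  | succ N ih =>
    have ih := ih (by omega)
    have hN : (N.factorial : ℝ) ≠ 0 := by exact_mod_cast N.factorial_ne_zero
    have hN' : (N : ℝ) + 1 ≠ 0 := by positivity
    rw [numer_succ, numer_succ, getD_pre p (by omega), Nat.factorial_succ]
    rcases lt_or_ge N M with hM | hM
    · rw [min_eq_right hM]
      rw [min_eq_right hM.le, sub_self, zero_mul] at ih
      have hd : decide (M ≤ N) = false := by simpa using hM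
      simp only [hd, Bool.and_false, cond_false]
      push_cast
      linear_combination ((N : ℝ) + 1) * ih
    · rw [min_eq_left (by omega), harmonicPartial_succ]
      rw [min_eq_left hM] at ih
      have hd : decide (M ≤ N) = true := by simpa using hM
      cases p (N + 1) <;> simp [hd] <;> field_simp <;> linear_combination ((N : ℝ) + 1) * ih

theorem primrec_factorial : Primrec Nat.factorial := by
  refine (Primrec.nat_rec₁ (f := fun k a => (k + 1) * a) 1 ?_).of_eq fun n => ?_
  · exact Primrec.nat_mul.comp (Primrec.succ.comp Primrec.fst) Primrec.snd
  · induction n with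
    | zero => rfl
    | succ n ih => rw [Nat.factorial_succ, ← ih]

theorem primrec_numer (β : Bool) {α : Type*} [Primcodable α] {M N : α → ℕ} {w : α → List Bool}
    (hM : Primrec M) (hw : Primrec w) (hN : Primrec N) :
    Primrec fun a => numer β (M a) (w a) (N a) := by
  refine Primrec.nat_rec' (g := fun _ => 0) (h := fun a q => q.2 * (q.1 + 1) +
    cond (((w a).getD (q.1 + 1) false == β) && decide (M a ≤ q.1)) q.1.factorial 0)
    hN (Primrec.const 0) ?_
  have hk : Primrec fun x : α × (ℕ × ℕ) => x.2.1 := Primrec.fst.comp Primrec.snd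
  have hk' : Primrec fun x : α × (ℕ × ℕ) => x.2.1 + 1 := Primrec.succ.comp hk
  refine Primrec.nat_add.comp (Primrec.nat_mul.comp (Primrec.snd.comp Primrec.snd) hk') ?_
  refine Primrec.cond (Primrec.and.comp ?_ ?_) (primrec_factorial.comp hk) (Primrec.const 0)
  · exact Primrec.beq.comp ((Primrec.list_getD false).comp (hw.comp Primrec.fst) hk')
      (Primrec.const β)
  · exact PrimrecPred.decide (PrimrecRel.comp Primrec.nat_le (hM.comp Primrec.fst) hk)

theorem primrec_pow : Primrec₂ ((· ^ ·) : ℕ → ℕ → ℕ) := Primrec₂.unpaired'.1 Nat.Primrec.pow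

/-! ### Convergence on random sequences -/

/-- The sum of the `± 1 / n` with `M < n < w.length`, with signs given by the word `w`. -/
noncomputable def wordSum (M : ℕ) (w : List Bool) : ℝ :=
  ∑ n ∈ Finset.range w.length,
    if M < n then (-1 : ℝ) ^ (w.getD n false).toNat / (n : ℝ) else 0

theorem wordSum_append (M : ℕ) (w : List Bool) (b : Bool) : wordSum M (w ++ [b]) =
    wordSum M w + if M < w.length then (-1 : ℝ) ^ b.toNat / (w.length : ℝ) else 0 := by
  rw [wordSum, List.length_append, List.length_singleton, Finset.sum_range_succ, wordSum]
  congr 1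
  · refine Finset.sum_congr rfl fun n hn => ?_
    rw [List.getD_append _ _ _ _ (Finset.mem_range.1 hn)]
  · simp [List.getD]

theorem wordSum_pre (M : ℕ) (p : Cantor) (N : ℕ) : wordSum M (pre p (N + 1)) =
    harmonicPartial p N - harmonicPartial p (min M N) := by
  induction N with
  | zero => simp [wordSum]
  | succ N ih =>
    rw [pre_succ, wordSum_append, ih, length_pre]
    rcases lt_or_ge M (N + 1) with h | h
    · rw [if_pos h, min_eq_left (by omega), min_eq_left (by omega), harmonicPartial_succ]
      ring
    · rw [if_neg (by omega), min_eq_right (by omega), min_eq_right (by omega)]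
      ring

/-- **Kolmogorov's inequality** for the random harmonic series. -/
theorem lebesgue_exists_le_sq {M : ℕ} (hM : 0 < M) {c : ℝ} (hc : 0 ≤ c) :
    lebesgue {p | ∃ N ≥ M, 1 ≤ c * (harmonicPartial p N - harmonicPartial p M) ^ 2} ≤
      ENNReal.ofReal (c / M) := by
  -- The square of a sum of independent signs grows on average by `1 / n ^ 2`. Past `M`, the fall of
  -- the second term from `1 / (n - 1)` to `1 / n` pays for this, so `g` is a supermartingale, with
  -- initial value `c / M`.
  let g : List Bool → ℝ := fun w => c * (wordSum M w ^ 2 + 1 / (max M (w.length - 1) : ℕ))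
  have hg : ∀ w, 0 ≤ g w := fun w => by positivity
  have hstep : ∀ w, g (w ++ [false]) + g (w ++ [true]) ≤ 2 * g w := by
    intro w
    simp only [g, wordSum_append, List.length_append, List.length_singleton, Nat.add_sub_cancel]
    rw [← mul_add, mul_left_comm]
    refine mul_le_mul_of_nonneg_left ?_ hc
    rcases lt_or_ge M w.length with h | h
    · rw [if_pos h, if_pos h, max_eq_right h.le, max_eq_right (by omega)]
      obtain ⟨L, hL⟩ : ∃ L, w.length = L + 1 := ⟨w.length - 1, by omega⟩
      rw [hL]
      have hL0 : (0 : ℝ) < L := by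
        have : 0 < L := by omega
        exact_mod_cast this
      have : 1 / ((L : ℝ) + 1) ^ 2 + 1 / ((L : ℝ) + 1) ≤ 1 / L := by
        rw [div_add_div _ _ (by positivity) (by positivity), div_le_div_iff₀ (by positivity) hL0]
        nlinarith [hL0]
      simp only [Bool.toNat_false, Bool.toNat_true, pow_zero, pow_one, Nat.add_sub_cancel]
      push_cast
      have e : (wordSum M w + 1 / ((L : ℝ) + 1)) ^ 2 + (wordSum M w + -1 / ((L : ℝ) + 1)) ^ 2 =
          2 * wordSum M w ^ 2 + 2 * (1 / ((L : ℝ) + 1) ^ 2) := by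
        field_simp
        ring
      linarith
    · rw [if_neg (by omega), if_neg (by omega), max_eq_left h, max_eq_left (by omega)]
      apply le_of_eq
      ring
  have hville := lebesgue_exists_one_le (f := fun w => ENNReal.ofReal (g w)) fun w => by
    rw [← ENNReal.ofReal_add (hg _) (hg _)]
    refine (ENNReal.ofReal_le_ofReal (hstep w)).trans_eq ?_
    rw [ENNReal.ofReal_mul (by norm_num)]
    simp
  refine (measure_mono ?_).trans (hville.trans_eq ?_)
  · rintro p ⟨N, hN, h⟩
    refine ⟨N + 1, ?_⟩
    rw [ENNReal.one_le_ofReal]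
    simp only [g, wordSum_pre, min_eq_left hN]
    refine h.trans (mul_le_mul_of_nonneg_left ?_ hc)
    have : (0 : ℝ) ≤ 1 / (max M ((pre p (N + 1)).length - 1) : ℕ) := by positivity
    linarith
  · simp [g, wordSum, div_eq_mul_inv]

/-- The position from which on the random harmonic series is expected to vary by at most
`2⁻ʲ`. -/
def cutoff (j : ℕ) : ℕ := 2 * 8 ^ j

theorem primrec_cutoff : Primrec cutoff :=
  Primrec.nat_mul.comp (Primrec.const 2) (primrec_pow.comp (Primrec.const 8) Primrec.id)

/-- The sequences whose harmonic series varies by more than `2⁻ʲ` after the `j`-th cutoff. -/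
def deviating (j : ℕ) : Set Cantor :=
  {p | ∃ N ≥ cutoff j, 1 < 2 ^ j * |harmonicPartial p N - harmonicPartial p (cutoff j)|}

/-- Kolmogorov's inequality with `c = 4 ^ j` gives `4 ^ j / (2 * 8 ^ j) = 2⁻¹ ^ (j + 1)`, which
explains the choice of `cutoff`. -/
theorem lebesgue_deviating_le (j : ℕ) : lebesgue (deviating j) ≤ (2⁻¹ : ℝ≥0∞) ^ (j + 1) := by
  have hpos : 0 < cutoff j := by unfold cutoff; positivity
  refine (measure_mono ?_).trans ((lebesgue_exists_le_sq hpos (c := 4 ^ j)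
    (by positivity)).trans_eq ?_)
  · rintro p ⟨N, hN, h⟩
    refine ⟨N, hN, ?_⟩
    have h4 : (4 : ℝ) ^ j = (2 ^ j) ^ 2 := by
      rw [← pow_mul, mul_comm, pow_mul]
      norm_num
    rw [h4, ← sq_abs (harmonicPartial p N - _), ← mul_pow]
    exact one_le_pow₀ h.le
  · have : (4 : ℝ) ^ j / (cutoff j : ℕ) = (2⁻¹ : ℝ) ^ (j + 1) := by
      have h8 : (8 : ℝ) ^ j = 4 ^ j * 2 ^ j := by rw [← mul_pow]; norm_num
      rw [cutoff]
      push_cast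
      rw [h8, pow_succ, inv_pow]
      field_simp
    rw [this, ENNReal.ofReal_pow (by norm_num), ENNReal.ofReal_inv_of_pos (by norm_num)]
    simp

theorem computableOpenSeq_deviating : ComputableOpenSeq deviating := by
  let P : ℕ → List Bool → Bool := fun j w =>
    let a := numer false (cutoff j) w (w.length - 1)
    let b := numer true (cutoff j) w (w.length - 1)
    -- With truncated subtraction, `(a - b) + (b - a)` is the absolute difference.
    decide ((w.length - 1).factorial < 2 ^ j * ((a - b) + (b - a)))
  have hP : Computable₂ P := by
    have hN : Primrec fun x : ℕ × List Bool => x.2.length - 1 :=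
      Primrec.pred.comp (Primrec.list_length.comp Primrec.snd)
    have hab : ∀ β, Primrec fun x : ℕ × List Bool =>
        numer β (cutoff x.1) x.2 (x.2.length - 1) := fun β =>
      primrec_numer β (primrec_cutoff.comp Primrec.fst) Primrec.snd hN
    refine Primrec.to_comp (α := ℕ × List Bool) (PrimrecPred.decide
      (PrimrecRel.comp Primrec.nat_lt (primrec_factorial.comp hN) (Primrec.nat_mul.comp
        (primrec_pow.comp (Primrec.const 2) Primrec.fst) (Primrec.nat_add.comp ?_ ?_))))
    · exact Primrec.nat_sub.comp (hab false) (hab true)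
    · exact Primrec.nat_sub.comp (hab true) (hab false)
  have key : ∀ j p m, P j (pre p m) = true ↔ 1 < 2 ^ j *
      |harmonicPartial p (m - 1) - harmonicPartial p (min (cutoff j) (m - 1))| := by
    intro j p m
    simp only [P, length_pre, decide_eq_true_eq]
    have h := numer_sub_numer p (cutoff j) (le_refl (m - 1))
    set a := numer false (cutoff j) (pre p m) (m - 1)
    set b := numer true (cutoff j) (pre p m) (m - 1)
    have habs : (((a - b) + (b - a) : ℕ) : ℝ) = |(a : ℝ) - b| := by
      rcases le_total a b with hab | hab
      · rw [abs_of_nonpos (by rw [sub_nonpos]; exact_mod_cast hab), Nat.sub_eq_zero_of_le hab]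
        push_cast [Nat.cast_sub hab]
        ring
      · rw [abs_of_nonneg (by rw [sub_nonneg]; exact_mod_cast hab), Nat.sub_eq_zero_of_le hab]
        push_cast [Nat.cast_sub hab]
        ring
    have hpos : (0 : ℝ) < (m - 1).factorial := by exact_mod_cast (m - 1).factorial_pos
    rw [← Nat.cast_lt (α := ℝ), Nat.cast_mul, habs, h, abs_mul, abs_of_pos hpos, ← mul_assoc]
    push_cast
    exact ⟨fun h => by nlinarith, fun h => by nlinarith⟩
  have : deviating = fun j => {p | ∃ n, P j (pre p n) = true} := by
    funext j
    ext p
    simp only [key, deviating, Set.mem_ofPred_eq]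
    constructor
    · rintro ⟨N, hN, h⟩
      exact ⟨N + 1, by rwa [Nat.add_sub_cancel, min_eq_left hN]⟩
    · rintro ⟨n, h⟩
      -- Before the cutoff the difference tested is `0`, so there are no false alarms.
      rcases lt_or_ge (n - 1) (cutoff j) with hn | hn
      · rw [min_eq_right hn.le] at h
        norm_num at h
      · exact ⟨n - 1, hn, by rwa [min_eq_left hn] at h⟩
  rw [this]
  exact computableOpenSeq_of_computable hP

theorem abs_sub_le_of_notMem_deviating {p : Cantor} {j N : ℕ} (h : p ∉ deviating j)
    (hN : cutoff j ≤ N) :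
    |harmonicPartial p N - harmonicPartial p (cutoff j)| ≤ (2⁻¹ : ℝ) ^ j := by
  have h' : ¬ 1 < 2 ^ j * |harmonicPartial p N - harmonicPartial p (cutoff j)| :=
    fun hlt => h ⟨N, hN, hlt⟩
  rw [inv_pow, ← one_div, le_div_iff₀ (by positivity), mul_comm]
  exact not_lt.1 h'

theorem exists_tendsto_harmonicPartial {p : Cantor} (hp : p ∈ MLR) :
    ∃ x, Tendsto (harmonicPartial p) atTop (𝓝 x) := by
  obtain ⟨i, hi⟩ := exists_forall_notMem_of_mem_MLR computableOpenSeq_deviating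
    lebesgue_deviating_le hp
  refine cauchySeq_tendsto_of_complete (Metric.cauchySeq_iff'.2 fun ε hε => ?_)
  obtain ⟨k, hk⟩ := exists_pow_lt_of_lt_one hε (by norm_num : (2⁻¹ : ℝ) < 1)
  refine ⟨cutoff (max i k), fun N hN => ?_⟩
  rw [Real.dist_eq]
  refine (abs_sub_le_of_notMem_deviating (hi _ (le_max_left _ _)) hN).trans_lt
    (lt_of_le_of_lt ?_ hk)
  exact pow_le_pow_of_le_one (by norm_num) (by norm_num) (le_max_right _ _)

theorem abs_cutoff_sub_le {p : Cantor} {j : ℕ} (h : p ∉ deviating j) {x : ℝ}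
    (hx : Tendsto (harmonicPartial p) atTop (𝓝 x)) :
    |harmonicPartial p (cutoff j) - x| ≤ (2⁻¹ : ℝ) ^ j := by
  rw [abs_sub_comm]
  refine le_of_tendsto (hx.sub_const _).abs ?_
  filter_upwards [eventually_ge_atTop (cutoff j)] with N hN
  exact abs_sub_le_of_notMem_deviating h hN

/-! ### Computing the harmonic series from a layer -/

/-- Codes of the rational approximations of the harmonic series of `p`, computed from
`interleave q r`, where `q` is a name of `p` and `r 0` is the number of a test set avoided
by `p`. -/
def sumEntry (j : ℕ) (u : List ℕ) : Option ℕ :=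
  let w := (List.range (u.length / 2)).map fun i => !(u.getD (2 * i) 0 == 0)
  let N := cutoff (max j (u.getD 1 0))
  cond (decide (2 * (N + 1) ≤ u.length))
    -- `ratOf` adds `1` to the coded denominator, hence `N.factorial - 1`.
    (some (Nat.pair (Nat.pair (numer false 0 w N) (numer true 0 w N)) (N.factorial - 1))) none

theorem computable_sumEntry : Computable₂ sumEntry := by
  have hN : Primrec fun x : ℕ × List ℕ => cutoff (max x.1 (x.2.getD 1 0)) :=
    primrec_cutoff.comp (Primrec.nat_max.comp Primrec.fst
      ((Primrec.list_getD 0).comp Primrec.snd (Primrec.const 1)))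
  have hlen : Primrec fun x : ℕ × List ℕ => x.2.length := Primrec.list_length.comp Primrec.snd
  have hw : Primrec fun x : ℕ × List ℕ =>
      (List.range (x.2.length / 2)).map fun i => !(x.2.getD (2 * i) 0 == 0) := by
    refine Primrec.list_map (g := fun (x : ℕ × List ℕ) i => !(x.2.getD (2 * i) 0 == 0))
      (Primrec.list_range.comp (Primrec.nat_div.comp hlen (Primrec.const 2))) ?_
    refine Primrec.not.comp (Primrec.beq.comp ((Primrec.list_getD 0).comp
      (Primrec.snd.comp Primrec.fst) ?_) (Primrec.const 0))
    exact Primrec.nat_mul.comp (Primrec.const 2) Primrec.snd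
  refine Primrec.to_comp (α := ℕ × List ℕ) (Primrec.cond ?_ (Primrec.option_some.comp
    (Primrec₂.natPair.comp (Primrec₂.natPair.comp ?_ ?_) ?_)) (Primrec.const none))
  · exact PrimrecPred.decide (PrimrecRel.comp Primrec.nat_le
      (Primrec.nat_mul.comp (Primrec.const 2) (Primrec.succ.comp hN)) hlen)
  · exact primrec_numer false (Primrec.const 0) hw hN
  · exact primrec_numer true (Primrec.const 0) hw hN
  · exact Primrec.pred.comp (primrec_factorial.comp hN)

theorem sumEntry_pre (q : Baire) (j m : ℕ) : sumEntry j (pre q m) =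
    let N := cutoff (max j (q 1))
    let w := pre (fun i => !(q (2 * i) == 0)) (N + 1)
    if 2 * (N + 1) ≤ m then
      some (Nat.pair (Nat.pair (numer false 0 w N) (numer true 0 w N)) (N.factorial - 1))
    else none := by
  -- On words of length at most `1` the layer is not yet readable and defaults to `0`. As cutoffs
  -- are at least `2`, the length guard fails there whatever the layer is.
  have hcut : ∀ k, 2 ≤ cutoff k := fun k => by
    have : 1 ≤ 8 ^ k := Nat.one_le_pow _ _ (by norm_num)
    unfold cutoff
    omega
  have hnum : ∀ β (p : Cantor) N n, N + 1 ≤ n →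
      numer β 0 (pre p n) N = numer β 0 (pre p (N + 1)) N := by
    intro β p N n hn
    have : ∀ k ≤ N, numer β 0 (pre p n) k = numer β 0 (pre p (N + 1)) k := by
      intro k
      induction k with
      | zero => intro _; rfl
      | succ k ih =>
        intro hk
        rw [numer_succ, numer_succ, ih (by omega), getD_pre p (by omega), getD_pre p (by omega)]
    exact this N le_rfl
  rcases lt_or_ge 1 m with hm | hm
  · have hw : (List.range (m / 2)).map
        (fun i => !((pre q m).getD (2 * i) 0 == 0)) = pre (fun i => !(q (2 * i) == 0)) (m / 2) := by
      refine List.map_congr_left fun i hi => ?_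
      rw [getD_pre q (by have := List.mem_range.1 hi; omega)]
    simp only [sumEntry, length_pre, hw]
    rw [getD_pre q hm]
    split_ifs with h
    · rw [decide_eq_true h, cond_true, hnum false _ _ (m / 2) (by omega),
        hnum true _ _ (m / 2) (by omega)]
    · rw [decide_eq_false h, cond_false]
  · have h₁ := hcut (max j (q 1))
    have h₂ := hcut (max j ((pre q m).getD 1 0))
    simp only [sumEntry, length_pre]
    rw [decide_eq_false (by omega), cond_false, if_neg (by omega)]

theorem extends_sumEntry : Extends sumEntry := by
  refine extends_of_pre fun q j m m' y hm h => ?_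
  rw [sumEntry_pre] at h ⊢
  simp only at h ⊢
  split_ifs at h with hj
  rw [if_pos (hj.trans hm), h]

theorem ratOf_pair (a b : ℕ) {d : ℕ} (hd : 0 < d) :
    ((ratOf (Nat.pair (Nat.pair a b) (d - 1)) : ℚ) : ℝ) = ((a : ℝ) - b) / d := by
  have : ((d - 1 : ℕ) : ℚ) + 1 = d := by
    rw [Nat.cast_pred hd]
    ring
  simp only [ratOf, Nat.unpair_pair, this]
  push_cast
  rfl

theorem randomHarmonic_weihrauchLE_LAY {U : ℕ → Set Cantor} (hU : IsUniversalMLTest U) :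
    WeihrauchLE randomHarmonic (LAY U) := by
  obtain ⟨PU, hPU⟩ := hU.1.1.exists_generates
  have hV : IsMLTest (tail deviating) :=
    isMLTest_tail computableOpenSeq_deviating lebesgue_deviating_le
  obtain ⟨PV, hPV⟩ := hV.1.exists_generates
  let Q : ℕ → List Bool → List Bool → Bool := fun i _ v => PU i v
  have hQ : Computable fun x : ℕ × List Bool × List Bool => Q x.1 x.2.1 x.2.2 :=
    hPU.computable.comp Computable.fst (Computable.snd.comp Computable.snd)
  refine ⟨entrywise sumEntry, entrywise (overwriteEntry (demand PV Q)),
    computableBaire_entrywise computable_sumEntry extends_sumEntry,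
    computableBaire_entrywise (computable_overwriteEntry (computable_demand hPV.computable hQ))
      extends_overwriteEntry, ?_⟩
  rintro G hG q ⟨p, hp⟩ hq -
  obtain ⟨x, hx⟩ := exists_tendsto_harmonicPartial hp
  set r := overwrite (demand PV Q) p with hr
  obtain ⟨hrM, hrV⟩ := overwrite_demand hPV hr hp (hV.exists_forall_notMem hp)
    -- Membership in `U i` persists along `r`, and universality puts any sequence ending in zeros
    -- into every `U i`.
    (fun i n m hnm h => hPU.mono (pre_prefix r hnm) h) fun i h => by
      obtain ⟨N, hN⟩ := eventually_atTop.1 h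
      exact hPU.mem_iff.1 (hU.mem_of_notMem_MLR (notMem_MLR_of_eventually_false hN) i)
  have hlay : (LAY U ⟨r, hrM⟩).Nonempty := by
    obtain ⟨i, hi⟩ := hU.1.exists_forall_notMem hrM
    exact ⟨i, hi i le_rfl⟩
  obtain ⟨s, hs, n, hn, hsn⟩ := hG (fun n => (r n).toNat) ⟨r, hrM⟩ (fun _ => rfl) hlay
  -- If `p` deviated at some `j ≥ n`, it would lie in the `n`-th tail, and `r` would have been
  -- forced into `U n`.
  have hpn : ∀ j ≥ n, p ∉ deviating j := by
    intro j hj hpj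
    refine hn (hPU.mem_iff.2 (hrV n (Set.mem_iUnion.2 ⟨j - n, ?_⟩)))
    rwa [Nat.add_sub_cancel' hj]
  have hs0 : interleave q s 1 = n := hsn
  have hbits : (fun i => !(interleave q s (2 * i) == 0)) = p := by
    funext i
    have : q i = (p i).toNat := hq i
    simp only [interleave, Nat.mul_mod_right, if_true, Nat.mul_div_cancel_left i two_pos, this]
    cases p i <;> rfl
  let N : ℕ → ℕ := fun j => cutoff (max j n)
  refine ⟨fun j => Nat.pair (Nat.pair (numer false 0 (pre p (N j + 1)) (N j))
    (numer true 0 (pre p (N j + 1)) (N j))) ((N j).factorial - 1), ?_, x, hx, fun j => ?_⟩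
  · refine Part.mem_bind_iff.2 ⟨_, mem_entrywise_overwriteEntry hq, Part.mem_bind_iff.2
      ⟨s, hs, (mem_entrywise extends_sumEntry).2 fun j => ⟨2 * (N j + 1), ?_⟩⟩⟩
    rw [sumEntry_pre, hs0, hbits]
    simp [N]
  · rw [ratOf_pair _ _ (Nat.factorial_pos _), numer_sub_numer p 0 (by omega), Nat.zero_min,
      mul_div_cancel_right₀ _ (by exact_mod_cast Nat.factorial_ne_zero _)]
    have h0 : harmonicPartial p 0 = 0 := by simp [harmonicPartial]
    rw [h0, sub_zero]
    refine (abs_cutoff_sub_le (hpn _ (le_max_right _ _)) hx).trans ?_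
    exact pow_le_pow_of_le_one (by norm_num) (by norm_num) (le_max_left _ _)

/-! ### Computing a layer from the harmonic series -/

/-- An upper bound for the real number named by `r`, computed from `interleave q r`. -/
def boundEntry (_ : ℕ) (u : List ℕ) : Option ℕ := u[1]?.map fun k => k.unpair.1.unpair.1 + 1

theorem computable_boundEntry : Computable₂ boundEntry := by
  refine Primrec.to_comp (α := ℕ × List ℕ) (Primrec.option_map
    (g := fun _ (k : ℕ) => k.unpair.1.unpair.1 + 1)
    (Primrec.list_getElem?.comp Primrec.snd (Primrec.const 1)) ?_)
  exact Primrec.succ.comp (Primrec.fst.comp (Primrec.unpair.comp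
    (Primrec.fst.comp (Primrec.unpair.comp Primrec.snd))))

theorem boundEntry_pre (q : Baire) (j m : ℕ) : boundEntry j (pre q m) =
    if 1 < m then some ((q 1).unpair.1.unpair.1 + 1) else none := by
  rw [boundEntry, getElem?_pre]
  split_ifs <;> rfl

theorem extends_boundEntry : Extends boundEntry := by
  refine extends_of_pre fun q j m m' y hm h => ?_
  rw [boundEntry_pre] at h ⊢
  split_ifs at h with hj
  rw [if_pos (hj.trans_le hm), h]

theorem ratOf_le (k : ℕ) : ((ratOf k : ℚ) : ℝ) ≤ k.unpair.1.unpair.1 := by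
  simp only [ratOf]
  push_cast
  rw [div_le_iff₀ (by positivity)]
  have h₁ : (0 : ℝ) ≤ k.unpair.1.unpair.1 := by positivity
  have h₂ : (0 : ℝ) ≤ k.unpair.1.unpair.2 := by positivity
  have h₃ : (0 : ℝ) ≤ k.unpair.2 := by positivity
  nlinarith [mul_nonneg h₁ h₃]

/-- The sequences with a partial sum of their harmonic series below `-i`. -/
def dropping (i : ℕ) : Set Cantor := {p | ∃ N, harmonicPartial p N < -(i : ℝ)}

theorem numer_sub_numer_zero (p : Cantor) (m : ℕ) :
    (numer false 0 (pre p m) (m - 1) : ℝ) - numer true 0 (pre p m) (m - 1) =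
      harmonicPartial p (m - 1) * (m - 1).factorial := by
  rw [numer_sub_numer p 0 le_rfl, Nat.zero_min]
  simp [harmonicPartial]

/-- Adding `dropping i` provides a lower bound for the partial sums of `p` wherever `p` avoids the
enlarged set. -/
theorem computableOpenSeq_union_dropping {U : ℕ → Set Cantor} (hU : ComputableOpenSeq U) :
    ComputableOpenSeq fun i => U i ∪ dropping i := by
  obtain ⟨P, hP⟩ := hU.exists_generates
  let D : ℕ → List Bool → Bool := fun i w => decide
    (numer false 0 w (w.length - 1) + i * (w.length - 1).factorial <
      numer true 0 w (w.length - 1))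
  have hD : Computable₂ D := by
    have hN : Primrec fun x : ℕ × List Bool => x.2.length - 1 :=
      Primrec.pred.comp (Primrec.list_length.comp Primrec.snd)
    refine Primrec.to_comp (α := ℕ × List Bool) (PrimrecPred.decide
      (PrimrecRel.comp Primrec.nat_lt (Primrec.nat_add.comp ?_
        (Primrec.nat_mul.comp Primrec.fst (primrec_factorial.comp hN))) ?_))
    · exact primrec_numer false (Primrec.const 0) Primrec.snd hN
    · exact primrec_numer true (Primrec.const 0) Primrec.snd hN
  have key : ∀ i p m, D i (pre p m) = true ↔ harmonicPartial p (m - 1) < -(i : ℝ) := by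
    intro i p m
    have h := numer_sub_numer_zero p m
    have hpos : (0 : ℝ) < (m - 1).factorial := by exact_mod_cast (m - 1).factorial_pos
    simp only [D, length_pre, decide_eq_true_eq]
    rw [← Nat.cast_lt (α := ℝ)]
    push_cast
    exact ⟨fun h' => by nlinarith, fun h' => by nlinarith⟩
  have : (fun i => U i ∪ dropping i) =
      fun i => {p | ∃ n, (P i (pre p n) || D i (pre p n)) = true} := by
    funext i
    ext p
    simp only [Set.mem_union, hP.mem_iff, dropping, Set.mem_ofPred_eq, Bool.or_eq_true,
      exists_or, key]
    refine or_congr_right ⟨fun ⟨N, hN⟩ => ⟨N + 1, by simpa using hN⟩, fun ⟨n, hn⟩ => ⟨_, hn⟩⟩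
  rw [this]
  exact computableOpenSeq_of_computable (P := fun i w => P i w || D i w)
    ((Primrec.or.to_comp).comp (α := ℕ × List Bool) hP.computable hD)

theorem exists_forall_notMem_dropping {p : Cantor} (hp : p ∈ MLR) :
    ∃ i, ∀ j ≥ i, p ∉ dropping j := by
  obtain ⟨x, hx⟩ := exists_tendsto_harmonicPartial hp
  obtain ⟨B, hB⟩ := hx.bddBelow_range
  obtain ⟨i, hi⟩ := exists_nat_ge (-B)
  refine ⟨i, fun j hj => ?_⟩
  rintro ⟨N, hN⟩
  have h₁ : B ≤ harmonicPartial p N := hB ⟨N, rfl⟩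
  have h₂ : (i : ℝ) ≤ j := by exact_mod_cast hj
  linarith

theorem tendsto_harmonicPartial_atTop {r : Cantor} (hr : ∀ᶠ n in atTop, r n = false) :
    Tendsto (harmonicPartial r) atTop atTop := by
  obtain ⟨M, hM⟩ := eventually_atTop.1 hr
  let C := harmonicPartial r M - ∑ i ∈ Finset.range M, 1 / ((i : ℝ) + 1)
  have h : ∀ N ≥ M, ∑ i ∈ Finset.range N, 1 / ((i : ℝ) + 1) + C = harmonicPartial r N := by
    intro N hN
    induction N, hN using Nat.le_induction with
    | base => simp [C]
    | succ N hN ih =>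
      rw [Finset.sum_range_succ, harmonicPartial_succ, ← ih, hM (N + 1) (by omega)]
      push_cast
      simp only [Bool.toNat_false, pow_zero]
      ring
  refine Tendsto.congr' ?_
    (tendsto_atTop_add_const_right _ C Real.tendsto_sum_range_one_div_nat_succ_atTop)
  filter_upwards [eventually_ge_atTop M] with N hN
  exact h N hN

/-- Overwriting only turns terms `-1 / n` into `1 / n`, so a lead once gained is never lost. -/
theorem harmonicPartial_sub_mono {p r : Cantor} (h : ∀ n, r n = true → p n = true) :
    Monotone fun N => harmonicPartial r N - harmonicPartial p N := by
  refine monotone_nat_of_le_succ fun N => ?_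
  rw [harmonicPartial_succ, harmonicPartial_succ]
  have : (-1 : ℝ) ^ (p (N + 1)).toNat / ((N + 1 : ℕ) : ℝ) ≤
      (-1 : ℝ) ^ (r (N + 1)).toNat / ((N + 1 : ℕ) : ℝ) := by
    gcongr ?_ / _
    have := h (N + 1)
    cases hr : r (N + 1) <;> cases hp : p (N + 1) <;> simp_all
  linarith

/-- Whether the harmonic sum of the word `v` exceeds that of `u`, of the same length, by at least
`2 * (i + 1)`. -/
def exceeds (i : ℕ) (u v : List Bool) : Bool :=
  let N := u.length - 1
  -- Negative terms are moved across the inequality to avoid truncated subtraction.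
  decide (numer false 0 u N + numer true 0 v N + 2 * (i + 1) * N.factorial ≤
    numer false 0 v N + numer true 0 u N)

theorem computable_exceeds :
    Computable fun x : ℕ × List Bool × List Bool => exceeds x.1 x.2.1 x.2.2 := by
  have hu : Primrec fun x : ℕ × List Bool × List Bool => x.2.1 := Primrec.fst.comp Primrec.snd
  have hv : Primrec fun x : ℕ × List Bool × List Bool => x.2.2 := Primrec.snd.comp Primrec.snd
  have hN : Primrec fun x : ℕ × List Bool × List Bool => x.2.1.length - 1 :=
    Primrec.pred.comp (Primrec.list_length.comp hu)
  refine Primrec.to_comp (PrimrecPred.decide (PrimrecRel.comp Primrec.nat_le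
    (Primrec.nat_add.comp (Primrec.nat_add.comp ?_ ?_) (Primrec.nat_mul.comp
      (Primrec.nat_mul.comp (Primrec.const 2) (Primrec.succ.comp Primrec.fst))
      (primrec_factorial.comp hN))) (Primrec.nat_add.comp ?_ ?_)))
  · exact primrec_numer false (Primrec.const 0) hu hN
  · exact primrec_numer true (Primrec.const 0) hv hN
  · exact primrec_numer false (Primrec.const 0) hv hN
  · exact primrec_numer true (Primrec.const 0) hu hN

theorem exceeds_pre (i : ℕ) (p r : Cantor) (n : ℕ) : exceeds i (pre p n) (pre r n) = true ↔
    2 * ((i : ℝ) + 1) ≤ harmonicPartial r (n - 1) - harmonicPartial p (n - 1) := by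
  have hp := numer_sub_numer_zero p n
  have hr := numer_sub_numer_zero r n
  have hpos : (0 : ℝ) < (n - 1).factorial := by exact_mod_cast (n - 1).factorial_pos
  simp only [exceeds, length_pre, decide_eq_true_eq]
  rw [← Nat.cast_le (α := ℝ), ← mul_le_mul_iff_left₀ (b := 2 * ((i : ℝ) + 1)) hpos, sub_mul, ← hp,
    ← hr]
  push_cast
  constructor <;> intro h <;> linarith

theorem LAY_weihrauchLE_randomHarmonic {U : ℕ → Set Cantor} (hU : IsMLTest U) :
    WeihrauchLE (LAY U) randomHarmonic := by
  obtain ⟨P, hP⟩ := (computableOpenSeq_union_dropping hU.1).exists_generates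
  refine ⟨entrywise boundEntry, entrywise (overwriteEntry (demand P exceeds)),
    computableBaire_entrywise computable_boundEntry extends_boundEntry,
    computableBaire_entrywise
      (computable_overwriteEntry (computable_demand hP.computable computable_exceeds))
      extends_overwriteEntry, ?_⟩
  rintro G hG q ⟨p, hp⟩ hq -
  obtain ⟨i₁, hi₁⟩ := hU.exists_forall_notMem hp
  obtain ⟨i₂, hi₂⟩ := exists_forall_notMem_dropping hp
  have hfin : ∃ i, ∀ j ≥ i, p ∉ U j ∪ dropping j := ⟨max i₁ i₂, fun j hj => by
    rintro (h | h)
    · exact hi₁ j (le_of_max_le_left hj) h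
    · exact hi₂ j (le_of_max_le_right hj) h⟩
  set r := overwrite (demand P exceeds) p with hr
  have hmono : Monotone fun N => harmonicPartial r N - harmonicPartial p N :=
    harmonicPartial_sub_mono fun n hn => by
      rw [hr, overwrite_apply, Bool.and_eq_true] at hn
      exact hn.2
  obtain ⟨hrM, hrV⟩ := overwrite_demand hP hr hp hfin
    (fun i n m hnm h => by
      rw [exceeds_pre] at h ⊢
      exact h.trans (hmono (Nat.sub_le_sub_right hnm 1)))
    -- If `r` ended in zeros its sum would diverge to infinity while that of `p` converges, so every
    -- required lead would be reached.
    (fun i h => by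
      obtain ⟨x, hx⟩ := exists_tendsto_harmonicPartial hp
      have ht := (tendsto_harmonicPartial_atTop h).atTop_add hx.neg
      obtain ⟨N, hN⟩ := (ht.eventually_ge_atTop (2 * ((i : ℝ) + 1))).exists
      exact ⟨N + 1, (exceeds_pre _ _ _ _).2 (by simpa [sub_eq_add_neg] using hN)⟩)
  obtain ⟨x', hx'⟩ := exists_tendsto_harmonicPartial hrM
  obtain ⟨s, hs, x, hx, hsx⟩ := hG (fun n => (r n).toNat) ⟨r, hrM⟩ (fun _ => rfl) ⟨x', hx'⟩
  -- The rational coded by `s 0` is at most the first component of its numerator and is within `1`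
  -- of the sum of `r`.
  let n := (s 0).unpair.1.unpair.1 + 1
  have hxn : x ≤ n := by
    have h₁ := (abs_le.1 (hsx 0)).1
    have h₂ := ratOf_le (s 0)
    simp only [n]
    push_cast
    rw [pow_zero] at h₁
    linarith
  have hpn : p ∉ U n := by
    intro hpn
    -- The test need not be nested, so `n` itself may not do: the membership at `i` gives the lead
    -- of `r`, the failure at `i + 1` the lower bound for `p`.
    obtain ⟨i, hni, hi, hi'⟩ : ∃ i ≥ n,
        p ∈ U i ∪ dropping i ∧ p ∉ U (i + 1) ∪ dropping (i + 1) := by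
      by_contra! hne
      obtain ⟨i, hi⟩ := hfin
      refine hi _ (le_max_right n i) ?_
      exact Nat.le_induction (Or.inl hpn) hne _ (le_max_left n i)
    obtain ⟨m, hm⟩ := hrV i hi
    rw [exceeds_pre] at hm
    have hlim : (i : ℝ) + 1 ≤ x := by
      refine ge_of_tendsto hx ?_
      filter_upwards [eventually_ge_atTop (m - 1)] with N hN
      have h₁ := hm.trans (hmono hN)
      have h₂ : -((i + 1 : ℕ) : ℝ) ≤ harmonicPartial p N :=
        not_lt.1 fun h => hi' (Or.inr ⟨N, h⟩)
      push_cast at h₂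
      linarith
    have : (n : ℝ) ≤ i := by exact_mod_cast hni
    linarith
  refine ⟨fun _ => n, ?_, n, hpn, rfl⟩
  refine Part.mem_bind_iff.2 ⟨_, mem_entrywise_overwriteEntry hq, Part.mem_bind_iff.2
    ⟨s, hs, (mem_entrywise extends_boundEntry).2 fun j => ⟨2, ?_⟩⟩⟩
  rw [boundEntry_pre]
  rfl

end LayerRed

theorem theorem27 (U : ℕ → Set LayerRed.Cantor) (hU : LayerRed.IsUniversalMLTest U) :
    (∀ p : LayerRed.MLR, ∃! x : ℝ, x ∈ LayerRed.randomHarmonic p) ∧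
      LayerRed.WeihrauchEquiv LayerRed.randomHarmonic (LayerRed.LAY U) := by
  refine ⟨fun p => ?_, LayerRed.randomHarmonic_weihrauchLE_LAY hU,
    LayerRed.LAY_weihrauchLE_randomHarmonic hU.1⟩
  obtain ⟨x, hx⟩ := LayerRed.exists_tendsto_harmonicPartial p.2
  exact ⟨x, hx, fun y hy => tendsto_nhds_unique hy hx⟩
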